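/- Let $S$ be a real-valued $C^\infty$ function on an open neighborhood $V$ of the origin in $\mathbb R^2$ with $S(0,0)=0$, $\nabla S(0,0)=0$, whose Taylor expansion $\sum_{a,b}s_{ab}x^ay^b$ at the origin is not identically zero. Let the Newton polygon $N(S)$ be the convex hull of $\bigcup_{s_{ab}\neq0}\{(t_1,t_2):t_1\ge a,\ t_2\ge b\}$, and let $d=\inf\{t:(t,t)\in N(S)\}$ be the Newton distance. For a compact edge $e$ of $N(S)$ put $S_e(x,y)=\sum_{(a,b)\in e}s_{ab}x^ay^b$. Assume that $S$ is in superadapted coordinates, i.e. for every compact edge $e$ of $N(S)$ that meets the line $t_1=t_2$, every real zero $y\ne0$ of $S_e(1,y)$ or of $S_e(-1,y)$ has order less than $d$; and assume $d>1$. For $\phi\in C_c^\infty(\mathbb R^2)$ real-valued and supported in $V$ and $\epsilon>0$ let $$I_{|S|,\phi}(\epsilon)=\int_{\{|S(x,y)|<\epsilon\}}\phi(x,y)\,dx\,dy .$$ Then there is a neighborhood $U\subseteq V$ of the origin, depending only on $S$, such that the following hold for every real-valued $\phi\in C_c^\infty(\mathbb R^2)$ supported in $U$ with $\phi(0,0)\neq0$;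 write $\sigma=\phi(0,0)/|\phi(0,0)|$ for the sign of $\phi(0,0)$. Case 1: if $(d,d)$ lies in the interior of a compact edge of $N(S)$, there is $A=A_{S,\phi}>0$ such that $\sigma\, I_{|S|,\phi}(\epsilon)>A\,\epsilon^{1/d}$ for all sufficiently small $\epsilon>0$. Case 2: if $(d,d)$ is a vertex of $N(S)$, there is $A=A_{S,\phi}>0$ such that $\sigma\, I_{|S|,\phi}(\epsilon)>A\,|\ln\epsilon|\,\epsilon^{1/d}$ for all sufficiently small $\epsilon>0$. Case 3: if $(d,d)$ lies in the interior of the horizontal or the vertical unbounded ray of the boundary of $N(S)$ and $\phi\ge0$ everywhere, then for every $\delta>0$ there is $A=A_{S,\phi,\delta}>0$ such that $I_{|S|,\phi}(\epsilon)>A\,\epsilon^{1/d+\delta}$ for all sufficiently small $\epsilon>0$. -/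

import Mathlib

open Set Filter Topology MeasureTheory Polynomial
open scoped ContDiff

noncomputable section

/-- The coefficient `s_ab = ∂_x^a ∂_y^b S (0,0) / (a! b!)` of `x^a y^b` in the Taylor expansion of
`S` at the origin. -/
def taylorCoeff (S : ℝ × ℝ → ℝ) (a b : ℕ) : ℝ :=
  iteratedDeriv a (fun x : ℝ => iteratedDeriv b (fun y : ℝ => S (x, y)) 0) 0 /
    ((a.factorial : ℝ) * (b.factorial : ℝ))

/-- The Newton polygon `N(S)`: the convex hull of the union of the quadrants
`{(t₁, t₂) : t₁ ≥ a, t₂ ≥ b}` over all `(a, b)` with `s_ab ≠ 0`. -/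
def newtonPolygon (S : ℝ × ℝ → ℝ) : Set (ℝ × ℝ) :=
  convexHull ℝ {t | ∃ a b : ℕ, taylorCoeff S a b ≠ 0 ∧ (a : ℝ) ≤ t.1 ∧ (b : ℝ) ≤ t.2}

/-- The Newton distance `d(S) = inf {t : (t, t) ∈ N(S)}`. -/
def newtonDistance (S : ℝ × ℝ → ℝ) : ℝ :=
  sInf {t : ℝ | (t, t) ∈ newtonPolygon S}

/-- The segment from `p` to `q` (with `p ≠ q`) is a compact edge of `N(S)`: it is a face of `N(S)`,
i.e. the set of points of `N(S)` at which some linear functional is maximal. -/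
def IsCompactEdge (S : ℝ × ℝ → ℝ) (p q : ℝ × ℝ) : Prop :=
  p ≠ q ∧ IsExposed ℝ (newtonPolygon S) (segment ℝ p q)

/-- The polynomial `S_e(c, y) = ∑_{(a,b) ∈ e} s_ab c^a y^b` in the variable `y`. The sum is finite
whenever `e` is bounded, in particular for every compact edge. -/
def edgePoly (S : ℝ × ℝ → ℝ) (e : Set (ℝ × ℝ)) (c : ℝ) : ℝ[X] :=
  ∑ᶠ (ab : ℕ × ℕ) (_ : ((ab.1 : ℝ), (ab.2 : ℝ)) ∈ e),
    Polynomial.monomial ab.2 (taylorCoeff S ab.1 ab.2 * c ^ ab.1)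

/-- `S` is in superadapted coordinates: for every compact edge `e` of `N(S)` that meets the
bisectrix `t₁ = t₂`, every real zero `r ≠ 0` of `S_e(1, y)` and of `S_e(-1, y)` has order less than
`d(S)`. -/
def IsSuperadapted (S : ℝ × ℝ → ℝ) : Prop :=
  ∀ p q : ℝ × ℝ, IsCompactEdge S p q → (∃ t : ℝ, (t, t) ∈ segment ℝ p q) →
    ∀ c : ℝ, c = 1 ∨ c = -1 → ∀ r : ℝ, r ≠ 0 → (edgePoly S (segment ℝ p q) c).IsRoot r →
      ((edgePoly S (segment ℝ p q) c).rootMultiplicity r : ℝ) < newtonDistance S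

/-- The bisectrix meets (the boundary of) `N(S)`, at the point `(d, d)`, in the interior of a
compact edge. -/
def NewtonCaseOne (S : ℝ × ℝ → ℝ) : Prop :=
  ∃ p q : ℝ × ℝ, IsCompactEdge S p q ∧
    (newtonDistance S, newtonDistance S) ∈ openSegment ℝ p q

/-- The bisectrix meets `N(S)` at a vertex `(d, d)`. -/
def NewtonCaseTwo (S : ℝ × ℝ → ℝ) : Prop :=
  (newtonDistance S, newtonDistance S) ∈ (newtonPolygon S).extremePoints ℝ

/-- The bisectrix meets `N(S)` in the interior of the horizontal ray `{(t, d) : t ≥ c}` or of the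
vertical ray `{(d, t) : t ≥ c}` of `N(S)`; being interior means that `c < d`. -/
def NewtonCaseThree (S : ℝ × ℝ → ℝ) : Prop :=
  ∃ c : ℝ, c < newtonDistance S ∧
    (IsExposed ℝ (newtonPolygon S) {t : ℝ × ℝ | c ≤ t.1 ∧ t.2 = newtonDistance S} ∨
      IsExposed ℝ (newtonPolygon S) {t : ℝ × ℝ | t.1 = newtonDistance S ∧ c ≤ t.2})

/-- `I_{|S|,φ}(ε)`: the integral of `φ` over `{|S| < ε}`, where `S` is a function on `V`. -/
def absSublevelIntegral (V : Set (ℝ × ℝ)) (S φ : ℝ × ℝ → ℝ) (ε : ℝ) : ℝ :=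
  ∫ p in {p : ℝ × ℝ | p ∈ V ∧ |S p| < ε}, φ p

end

/-! The mass of the sublevel set sits at the origin. Inside any ball about 0 the set `|S| < ε` has
measure at least `c * h ε`, with `h ε` the claimed order of growth; on a compact set in `U` avoiding
0, in Cases 1 and 2, it has measure `o(h ε)`. So `φ` may change sign away from 0, and only `φ 0`
decides.

Lower bounds: if the Taylor support lies in `w₁ a + w₂ b ≥ 1`, then `|S| < ε` on a box with sides of
order `ε ^ w₁` and `ε ^ w₂`. When the line `w₁ t₁ + w₂ t₂ = 1` supports `N(S)` at `(d, d)`, the area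
has order `ε ^ (1 / d)`. At a vertex there is an interval of such lines, and the boxes sweep out a
region under a hyperbola, which produces the logarithm. For an unbounded ray the weights `1 / d` and
`δ` are used.

Upper bounds: a nonzero pure derivative of order `k` in `x` or in `y` bounds the sublevel set
locally by `O(ε ^ (1 / k))` (`volume_sublevel_le`, `eventually_volume_inter_sublevel_le`). This is
`o(h ε)` for `k < d`, and thanks to the logarithm also for `k = d` at a vertex.

The core is that such a derivative exists at every point near, but different from, the origin
(`eventually_exists_deriv_ne_zero`). Otherwise all admissible derivatives vanish along an
ultrafilter tending to 0. Close to the axes one Taylor monomial forbids this. Elsewhere `|y|`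
behaves like `|x| ^ s` with `s > 0`, and rescaled Taylor expansions converge to sums over a
supporting line (`exists_degenerate_supporting_line`). The vanishing forces this line through `(d,
d)`. In Case 1 it then carries the principal edge, whose polynomial gets a root of order at least
`d`, against superadaptedness; in Case 2 `(d, d)` would lie strictly between two support points. -/

/-! ### Partial derivatives and Taylor expansion in two variables -/

/-- The `k`-th partial derivative in the second variable. -/
noncomputable def yDeriv (k : ℕ) (S : ℝ × ℝ → ℝ) (p : ℝ × ℝ) : ℝ :=
  iteratedDeriv k (fun y => S (p.1, y)) p.2

/-- The `k`-th partial derivative in the first variable. -/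
noncomputable def xDeriv (k : ℕ) (S : ℝ × ℝ → ℝ) (p : ℝ × ℝ) : ℝ :=
  iteratedDeriv k (fun x => S (x, p.2)) p.1

lemma xDeriv_eq_yDeriv_swap (k : ℕ) (S : ℝ × ℝ → ℝ) (p : ℝ × ℝ) :
    xDeriv k S p = yDeriv k (S ∘ Prod.swap) p.swap := rfl

lemma ContDiff.fderiv_apply_const {G : ℝ × ℝ → ℝ} (hG : ContDiff ℝ ∞ G) (v : ℝ × ℝ) :
    ContDiff ℝ ∞ (fun p => fderiv ℝ G p v) :=
  (hG.fderiv_right (m := ∞) (by simp)).clm_apply contDiff_const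

lemma deriv_snd_eq_fderiv {G : ℝ × ℝ → ℝ} (hG : ContDiff ℝ ∞ G) (p : ℝ × ℝ) :
    deriv (fun y => G (p.1, y)) p.2 = fderiv ℝ G p (0, 1) := by
  have h1 : HasFDerivAt G (fderiv ℝ G p) (p.1, p.2) :=
    (hG.differentiable (by simp) p).hasFDerivAt
  have h2 : HasDerivAt (fun y : ℝ => (p.1, y)) ((0 : ℝ), (1 : ℝ)) p.2 :=
    (hasDerivAt_const p.2 p.1).prodMk (hasDerivAt_id p.2)
  exact (h1.comp_hasDerivAt p.2 h2).deriv

lemma deriv_fst_eq_fderiv {G : ℝ × ℝ → ℝ} (hG : ContDiff ℝ ∞ G) (p : ℝ × ℝ) :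
    deriv (fun x => G (x, p.2)) p.1 = fderiv ℝ G p (1, 0) := by
  have h1 : HasFDerivAt G (fderiv ℝ G p) (p.1, p.2) :=
    (hG.differentiable (by simp) p).hasFDerivAt
  have h2 : HasDerivAt (fun x : ℝ => (x, p.2)) ((1 : ℝ), (0 : ℝ)) p.1 :=
    (hasDerivAt_id p.1).prodMk (hasDerivAt_const p.1 p.2)
  exact (h1.comp_hasDerivAt p.1 h2).deriv

lemma contDiff_iterate_fderiv {G : ℝ × ℝ → ℝ} (hG : ContDiff ℝ ∞ G) (v : ℝ × ℝ) (k : ℕ) :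
    ContDiff ℝ ∞ ((fun (H : ℝ × ℝ → ℝ) p => fderiv ℝ H p v)^[k] G) := by
  induction k with
  | zero => exact hG
  | succ k ih =>
    rw [Function.iterate_succ_apply']
    exact ih.fderiv_apply_const v

lemma yDeriv_eq_iterate {G : ℝ × ℝ → ℝ} (hG : ContDiff ℝ ∞ G) (k : ℕ) :
    yDeriv k G = (fun (H : ℝ × ℝ → ℝ) p => fderiv ℝ H p (0, 1))^[k] G := by
  induction k with
  | zero => ext p; simp [yDeriv]
  | succ k ih =>
    rw [Function.iterate_succ_apply', ← ih]
    have h := contDiff_iterate_fderiv hG (0, 1) k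
    rw [← ih] at h
    ext p
    rw [← deriv_snd_eq_fderiv h, yDeriv, iteratedDeriv_succ]
    rfl

lemma xDeriv_eq_iterate {G : ℝ × ℝ → ℝ} (hG : ContDiff ℝ ∞ G) (k : ℕ) :
    xDeriv k G = (fun (H : ℝ × ℝ → ℝ) p => fderiv ℝ H p (1, 0))^[k] G := by
  induction k with
  | zero => ext p; simp [xDeriv]
  | succ k ih =>
    rw [Function.iterate_succ_apply', ← ih]
    have h := contDiff_iterate_fderiv hG (1, 0) k
    rw [← ih] at h
    ext p
    rw [← deriv_fst_eq_fderiv h, xDeriv, iteratedDeriv_succ]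
    rfl

lemma contDiff_yDeriv {G : ℝ × ℝ → ℝ} (hG : ContDiff ℝ ∞ G) (k : ℕ) :
    ContDiff ℝ ∞ (yDeriv k G) := by
  rw [yDeriv_eq_iterate hG]; exact contDiff_iterate_fderiv hG _ k

lemma contDiff_xDeriv {G : ℝ × ℝ → ℝ} (hG : ContDiff ℝ ∞ G) (k : ℕ) :
    ContDiff ℝ ∞ (xDeriv k G) := by
  rw [xDeriv_eq_iterate hG]; exact contDiff_iterate_fderiv hG _ k

lemma fderiv_fderiv_apply_comm {G : ℝ × ℝ → ℝ} (hG : ContDiff ℝ ∞ G) (v w p : ℝ × ℝ) :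
    fderiv ℝ (fun q => fderiv ℝ G q v) p w = fderiv ℝ (fun q => fderiv ℝ G q w) p v := by
  have h1 : DifferentiableAt ℝ (fderiv ℝ G) p :=
    (hG.fderiv_right (m := ∞) (by simp)).differentiable (by simp) p
  have hs : IsSymmSndFDerivAt ℝ G p :=
    hG.contDiffAt.isSymmSndFDerivAt (by
      rw [minSmoothness_of_isRCLikeNormedField]; exact ENat.LEInfty.out)
  have key : ∀ u : ℝ × ℝ, fderiv ℝ (fun q => fderiv ℝ G q u) p =
      (fderiv ℝ (fderiv ℝ G) p).flip u := by
    intro u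
    rw [fderiv_clm_apply h1 (differentiableAt_const u)]
    simp
  rw [key, key]
  exact hs w v

lemma xDeriv_yDeriv_comm {G : ℝ × ℝ → ℝ} (hG : ContDiff ℝ ∞ G) (a b : ℕ) :
    xDeriv a (yDeriv b G) = yDeriv b (xDeriv a G) := by
  rw [xDeriv_eq_iterate (contDiff_yDeriv hG b), yDeriv_eq_iterate (contDiff_xDeriv hG a),
    yDeriv_eq_iterate hG, xDeriv_eq_iterate hG]
  set D₁ := fun (H : ℝ × ℝ → ℝ) p => fderiv ℝ H p (1, 0)
  set D₂ := fun (H : ℝ × ℝ → ℝ) p => fderiv ℝ H p (0, 1)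
  have h1 : ∀ (b : ℕ) (H : ℝ × ℝ → ℝ), ContDiff ℝ ∞ H → D₁ (D₂^[b] H) = D₂^[b] (D₁ H) := by
    intro b
    induction b with
    | zero => intro H _; rfl
    | succ b ih =>
      intro H hH
      rw [Function.iterate_succ_apply, ih _ (hH.fderiv_apply_const _),
        Function.iterate_succ_apply]
      congr 1
      ext p
      exact fderiv_fderiv_apply_comm hH _ _ p
  induction a with
  | zero => rfl
  | succ a ih =>
    rw [Function.iterate_succ_apply', Function.iterate_succ_apply', ih,
      h1 b _ (contDiff_iterate_fderiv hG _ a)]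

/-- `taylorCoeff` differentiates in `y` before `x`, so the symmetry rests on commuting mixed
derivatives. It transfers statements about `y`-derivatives to `x`-derivatives. -/
lemma taylorCoeff_swap {S : ℝ × ℝ → ℝ} (hS : ContDiff ℝ ∞ S) (a b : ℕ) :
    taylorCoeff (S ∘ Prod.swap) a b = taylorCoeff S b a := by
  have h := congrFun (xDeriv_yDeriv_comm hS b a) 0
  change iteratedDeriv a (fun x : ℝ => iteratedDeriv b (fun y : ℝ => S (y, x)) 0) 0 / _ = _
  change iteratedDeriv b (fun x : ℝ => iteratedDeriv a (fun y : ℝ => S (x, y)) 0) 0 =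
    iteratedDeriv a (fun x : ℝ => iteratedDeriv b (fun y : ℝ => S (y, x)) 0) 0 at h
  rw [taylorCoeff, h, mul_comm]

lemma taylorCoeff_yDeriv (S : ℝ × ℝ → ℝ) (k i j : ℕ) :
    taylorCoeff (yDeriv k S) i j = taylorCoeff S i (j + k) * ((j + k).descFactorial k : ℝ) := by
  have h : ∀ x : ℝ, iteratedDeriv j (fun y : ℝ => yDeriv k S (x, y)) 0 =
      iteratedDeriv (j + k) (fun y => S (x, y)) 0 := by
    intro x
    change iteratedDeriv j (iteratedDeriv k (fun y => S (x, y))) 0 = _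
    rw [iteratedDeriv_eq_iterate, iteratedDeriv_eq_iterate, iteratedDeriv_eq_iterate,
      Function.iterate_add_apply]
  have h2 : ((j + k).factorial : ℝ) = (j.factorial : ℝ) * ((j + k).descFactorial k : ℝ) := by
    have := Nat.factorial_mul_descFactorial (n := j + k) (k := k) (by omega)
    rw [Nat.add_sub_cancel] at this
    exact_mod_cast this.symm
  have h3 : ((j + k).descFactorial k : ℝ) ≠ 0 := by
    have : (j + k).descFactorial k ≠ 0 := by
      rw [Ne, Nat.descFactorial_eq_zero_iff_lt]; omega
    exact_mod_cast this
  simp only [taylorCoeff, h, h2]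
  field_simp

/-- Taylor's formula with a remainder bound, on `[-1, 1]`. -/
lemma abs_sub_taylor_le (n : ℕ) {f : ℝ → ℝ} (hf : ContDiff ℝ ∞ f) {C : ℝ}
    (hC : ∀ t, |t| ≤ 1 → |iteratedDeriv n f t| ≤ C) {t : ℝ} (ht : |t| ≤ 1) :
    |f t - ∑ j ∈ Finset.range n, iteratedDeriv j f 0 / (j.factorial : ℝ) * t ^ j| ≤
      C * |t| ^ n := by
  induction n generalizing f t with
  | zero => simpa using hC t ht
  | succ n ih =>
    have hf' : ContDiff ℝ ∞ (deriv f) := (contDiff_infty_iff_deriv.1 hf).2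
    have ih' := fun (s : ℝ) (hs : |s| ≤ 1) => ih hf' (by simpa [← iteratedDeriv_succ'] using hC) hs
    set g : ℝ → ℝ := fun t => f t -
      ∑ j ∈ Finset.range (n + 1), iteratedDeriv j f 0 / (j.factorial : ℝ) * t ^ j with hg
    -- The derivative of the remainder of order `n + 1` is the remainder of order `n` of `deriv f`;
    -- the induction hypothesis and the mean value inequality on `[-|t|, |t|]` then finish.
    have hd : ∀ s, HasDerivAt g (deriv f s -
        ∑ j ∈ Finset.range n, iteratedDeriv j (deriv f) 0 / (j.factorial : ℝ) * s ^ j) s := by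
      intro s
      refine (hf.differentiable (by simp) s).hasDerivAt.sub ?_
      have : HasDerivAt (fun t : ℝ => ∑ j ∈ Finset.range (n + 1),
          iteratedDeriv j f 0 / (j.factorial : ℝ) * t ^ j)
          (∑ j ∈ Finset.range (n + 1),
          iteratedDeriv j f 0 / (j.factorial : ℝ) * ((j : ℝ) * s ^ (j - 1))) s :=
        HasDerivAt.fun_sum fun j _ => (hasDerivAt_pow j s).const_mul _
      refine this.congr_deriv ?_
      rw [Finset.sum_range_succ']
      simp only [Nat.cast_zero, zero_mul, mul_zero, add_zero]
      refine Finset.sum_congr rfl fun j _ => ?_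
      rw [← iteratedDeriv_succ', Nat.factorial_succ, Nat.add_sub_cancel]
      have : (j.factorial : ℝ) ≠ 0 := by positivity
      push_cast
      field_simp
    have hC0 : 0 ≤ C := (abs_nonneg _).trans (hC 0 (by simp))
    have hg0 : g 0 = 0 := by
      simp [hg, Finset.sum_range_succ']
    have key := Convex.norm_image_sub_le_of_norm_deriv_le (𝕜 := ℝ) (f := g) (s := Icc (-|t|) |t|)
      (C := C * |t| ^ n) (x := 0) (y := t) (fun s _ => (hd s).differentiableAt) (fun s hs => by
        rw [(hd s).deriv, Real.norm_eq_abs]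
        have hst : |s| ≤ |t| := abs_le.2 hs
        refine (ih' s (hst.trans ht)).trans ?_
        gcongr) (convex_Icc _ _) (by simp) (abs_le.1 le_rfl)
    rw [hg0, sub_zero, sub_zero, Real.norm_eq_abs, Real.norm_eq_abs] at key
    calc |g t| ≤ C * |t| ^ n * |t| := key
      _ = C * |t| ^ (n + 1) := by ring

/-- Taylor's formula in two variables, expanded to order `A` in `x` and to order `B` in `y`. -/
lemma exists_abs_sub_taylor_two_le {G : ℝ × ℝ → ℝ} (hG : ContDiff ℝ ∞ G) (A B : ℕ) :
    ∃ C, 0 ≤ C ∧ ∀ x y : ℝ, |x| ≤ 1 → |y| ≤ 1 →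
      |G (x, y) - ∑ i ∈ Finset.range A, ∑ j ∈ Finset.range B, taylorCoeff G i j * x ^ i * y ^ j| ≤
        C * (|x| ^ A + |y| ^ B) := by
  have hbd : ∀ H : ℝ × ℝ → ℝ, ContDiff ℝ ∞ H →
      ∃ C, 0 ≤ C ∧ ∀ x y : ℝ, |x| ≤ 1 → |y| ≤ 1 → |H (x, y)| ≤ C := by
    intro H hH
    obtain ⟨C, hC⟩ := ((isCompact_Icc (a := (-1 : ℝ)) (b := 1)).prod
      (isCompact_Icc (a := (-1 : ℝ)) (b := 1))).exists_bound_of_continuousOn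
      hH.continuous.continuousOn
    refine ⟨C, (norm_nonneg _).trans (hC (0, 0) ⟨by simp, by simp⟩), fun x y hx hy => ?_⟩
    exact hC (x, y) ⟨abs_le.1 hx, abs_le.1 hy⟩
  obtain ⟨C₀, hC₀, hC₀'⟩ := hbd _ (contDiff_yDeriv hG B)
  choose D hD hD' using fun j => hbd _ (contDiff_xDeriv (contDiff_yDeriv hG j) A)
  refine ⟨C₀ + ∑ j ∈ Finset.range B, D j, add_nonneg hC₀ (Finset.sum_nonneg fun j _ => hD j),
    fun x y hx hy => ?_⟩
  -- The expansion is in `y` at fixed `x`, and then in `x` for each coefficient `∂_y ^ j G (x, 0)`;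
  -- no mixed remainder arises.
  have h1 := abs_sub_taylor_le B (f := fun y => G (x, y))
    (hG.comp (contDiff_const.prodMk contDiff_id)) (fun t ht => hC₀' x t hx ht) hy
  have h2 := fun j : ℕ => abs_sub_taylor_le A (f := fun x => yDeriv j G (x, 0))
    ((contDiff_yDeriv hG j).comp (contDiff_id.prodMk contDiff_const))
    (fun t ht => hD' j t 0 ht (by simp)) hx
  have h3 : (∑ j ∈ Finset.range B, iteratedDeriv j (fun y => G (x, y)) 0 / (j.factorial : ℝ) *
        y ^ j) -
      ∑ i ∈ Finset.range A, ∑ j ∈ Finset.range B, taylorCoeff G i j * x ^ i * y ^ j =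
      ∑ j ∈ Finset.range B, (yDeriv j G (x, 0) - ∑ i ∈ Finset.range A,
        iteratedDeriv i (fun x => yDeriv j G (x, 0)) 0 / (i.factorial : ℝ) * x ^ i) *
          (y ^ j / (j.factorial : ℝ)) := by
    rw [Finset.sum_comm, ← Finset.sum_sub_distrib]
    refine Finset.sum_congr rfl fun j _ => ?_
    have : ∀ i, taylorCoeff G i j * x ^ i * y ^ j =
        iteratedDeriv i (fun x => yDeriv j G (x, 0)) 0 / (i.factorial : ℝ) * x ^ i *
          (y ^ j / (j.factorial : ℝ)) := by
      intro i
      change iteratedDeriv i (fun x => yDeriv j G (x, 0)) 0 / ((i.factorial : ℝ) * j.factorial) *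
        x ^ i * y ^ j = _
      field_simp
    simp only [this, ← Finset.sum_mul, sub_mul, yDeriv]
    congr 1
    ring
  have h4 : |∑ j ∈ Finset.range B, (yDeriv j G (x, 0) - ∑ i ∈ Finset.range A,
        iteratedDeriv i (fun x => yDeriv j G (x, 0)) 0 / (i.factorial : ℝ) * x ^ i) *
          (y ^ j / (j.factorial : ℝ))| ≤ (∑ j ∈ Finset.range B, D j) * |x| ^ A := by
    rw [Finset.sum_mul]
    refine (Finset.abs_sum_le_sum_abs _ _).trans (Finset.sum_le_sum fun j _ => ?_)
    rw [abs_mul]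
    have h5 : |y ^ j / (j.factorial : ℝ)| ≤ 1 := by
      rw [abs_div, abs_pow, Nat.abs_cast]
      have : (1 : ℝ) ≤ j.factorial := by exact_mod_cast Nat.one_le_iff_ne_zero.2 j.factorial_ne_zero
      exact div_le_one_of_le₀ ((pow_le_one₀ (abs_nonneg _) hy).trans this) (by positivity)
    calc _ ≤ D j * |x| ^ A * 1 := mul_le_mul (h2 j) h5 (abs_nonneg _)
          (mul_nonneg (hD j) (by positivity))
      _ = _ := mul_one _
  have hDs : 0 ≤ ∑ j ∈ Finset.range B, D j := Finset.sum_nonneg fun j _ => hD j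
  rw [← h3] at h4
  have h6 := abs_add_le _ _ |>.trans (add_le_add h1 h4)
  rw [sub_add_sub_cancel] at h6
  refine h6.trans ?_
  have hx' : 0 ≤ |x| ^ A := by positivity
  have hy' : 0 ≤ |y| ^ B := by positivity
  nlinarith [mul_nonneg hC₀ hx', mul_nonneg hDs hy']

/-- The Taylor expansion of `y ^ k * ∂_y ^ k S`. -/
lemma exists_abs_pow_mul_yDeriv_sub_le {S : ℝ × ℝ → ℝ} (hS : ContDiff ℝ ∞ S) {k N : ℕ}
    (hk : k ≤ N) :
    ∃ C, 0 ≤ C ∧ ∀ x y : ℝ, |x| ≤ 1 → |y| ≤ 1 →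
      |y ^ k * yDeriv k S (x, y) - ∑ ab ∈ Finset.range N ×ˢ Finset.range N,
          taylorCoeff S ab.1 ab.2 * (ab.2.descFactorial k : ℝ) * (x ^ ab.1 * y ^ ab.2)| ≤
        C * (|x| ^ N + |y| ^ N) := by
  -- Order `N - k` in `y` suffices, as the factor `y ^ k` restores order `N`. The descending
  -- factorial kills the terms with exponent below `k`, so every `k` uses the same index set.
  obtain ⟨C, hC, h⟩ := exists_abs_sub_taylor_two_le (contDiff_yDeriv hS k) N (N - k)
  refine ⟨C, hC, fun x y hx hy => ?_⟩
  have h1 : ∑ ab ∈ Finset.range N ×ˢ Finset.range N,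
        taylorCoeff S ab.1 ab.2 * (ab.2.descFactorial k : ℝ) * (x ^ ab.1 * y ^ ab.2) =
      y ^ k * ∑ i ∈ Finset.range N, ∑ j ∈ Finset.range (N - k),
        taylorCoeff (yDeriv k S) i j * x ^ i * y ^ j := by
    rw [Finset.sum_product, Finset.mul_sum]
    refine Finset.sum_congr rfl fun i _ => ?_
    obtain ⟨M, rfl⟩ := Nat.exists_eq_add_of_le hk
    rw [Finset.sum_range_add, Nat.add_sub_cancel_left, Finset.mul_sum]
    have h0 : ∑ j ∈ Finset.range k,
        taylorCoeff S i j * (j.descFactorial k : ℝ) * (x ^ i * y ^ j) = 0 := by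
      refine Finset.sum_eq_zero fun j hj => ?_
      rw [Nat.descFactorial_of_lt (Finset.mem_range.1 hj)]
      simp
    simp only [h0, zero_add]
    refine Finset.sum_congr rfl fun j _ => ?_
    rw [taylorCoeff_yDeriv, add_comm k j, pow_add]
    ring
  rw [h1, ← mul_sub, abs_mul, abs_pow]
  have hyk : |y| ^ k ≤ 1 := pow_le_one₀ (abs_nonneg _) hy
  have hyN : |y| ^ N = |y| ^ k * |y| ^ (N - k) := by rw [← pow_add, Nat.add_sub_cancel' hk]
  calc _ ≤ |y| ^ k * (C * (|x| ^ N + |y| ^ (N - k))) := by gcongr; exact h x y hx hy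
    _ = C * (|y| ^ k * |x| ^ N + |y| ^ N) := by rw [hyN]; ring
    _ ≤ C * (1 * |x| ^ N + |y| ^ N) := by gcongr
    _ = _ := by rw [one_mul]

/-! ### Upper bounds for the measure of sublevel sets -/

/-- One-dimensional sublevel set estimate: if `f⁽ᵏ⁾ ≥ lam` on an interval, then
`|f| < lam * μ ^ k` only on a set of measure `O(μ)`. -/
lemma volume_sublevel_le {f : ℝ → ℝ} (hf : ContDiff ℝ ∞ f) (k : ℕ) {I : Set ℝ}
    (hI : I.OrdConnected) {lam μ : ℝ} (hlam : 0 < lam) (hμ : 0 < μ)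
    (h : ∀ t ∈ I, lam ≤ iteratedDeriv k f t) :
    volume {t | t ∈ I ∧ |f t| < lam * μ ^ k} ≤ ENNReal.ofReal (4 ^ k * μ) := by
  induction k generalizing f I lam with
  | zero =>
    have : {t | t ∈ I ∧ |f t| < lam * μ ^ 0} = ∅ := by
      ext t
      simp only [pow_zero, mul_one, mem_ofPred_eq, mem_empty_iff_false, iff_false, not_and, not_lt]
      intro ht
      exact (h t ht).trans (by simpa using le_abs_self (f t))
    rw [this]; simp
  | succ k ih =>
    set g := iteratedDeriv k f with hg
    have hgs : Differentiable ℝ g := hf.differentiable_iteratedDeriv k (by exact_mod_cast ENat.natCast_lt_top k)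
    have hinc : ∀ s ∈ I, ∀ t ∈ I, s ≤ t → lam * (t - s) ≤ g t - g s := by
      refine hI.convex.mul_sub_le_image_sub_of_le_deriv hgs.continuous.continuousOn
        hgs.differentiableOn fun t ht => ?_
      have := h t (interior_subset ht)
      rwa [iteratedDeriv_succ] at this
    have hmono : ∀ s ∈ I, ∀ t ∈ I, s ≤ t → g s ≤ g t := fun s hs t ht hst => by
      nlinarith [hinc s hs t ht hst, mul_nonneg hlam.le (sub_nonneg.2 hst)]
    -- Since `g` increases with slope at least `lam`, `I` splits into two intervals where `|g| ≥ lam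
    -- * μ`, handled by induction, and a set of diameter at most `2 * μ`. The constants add up by `2
    -- * 4 ^ k + 2 ≤ 4 ^ (k + 1)`.
    have hP : {t | t ∈ I ∧ lam * μ ≤ g t}.OrdConnected := by
      refine ⟨fun s hs t ht u hu => ?_⟩
      have huI := hI.out hs.1 ht.1 hu
      exact ⟨huI, hs.2.trans (hmono s hs.1 u huI hu.1)⟩
    have hM : {t | t ∈ I ∧ lam * μ ≤ -g t}.OrdConnected := by
      refine ⟨fun s hs t ht u hu => ?_⟩
      have huI := hI.out hs.1 ht.1 hu
      exact ⟨huI, ht.2.trans (neg_le_neg (hmono u huI t ht.1 hu.2))⟩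
    have h1 := ih hf hP (mul_pos hlam hμ) fun t ht => ht.2
    have h2 := ih (f := fun t => -f t) hf.neg hM (mul_pos hlam hμ) fun t ht => by
      have := iteratedDeriv_neg k f t
      have h' : iteratedDeriv k (fun t => -f t) t = -g t := this
      rw [h']; exact ht.2
    have h3 : volume {t | t ∈ I ∧ |g t| < lam * μ} ≤ ENNReal.ofReal (2 * μ) := by
      refine (Real.volume_le_diam _).trans (Metric.ediam_le fun s hs t ht => ?_)
      rw [edist_dist, Real.dist_eq]
      refine ENNReal.ofReal_le_ofReal ?_
      obtain ⟨hs1, hs2⟩ := abs_lt.1 hs.2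
      obtain ⟨ht1, ht2⟩ := abs_lt.1 ht.2
      rcases le_total s t with hst | hst
      · rw [abs_sub_comm, abs_of_nonneg (sub_nonneg.2 hst)]
        have := hinc s hs.1 t ht.1 hst
        by_contra! hc
        nlinarith [mul_lt_mul_of_pos_left hc hlam]
      · rw [abs_of_nonneg (sub_nonneg.2 hst)]
        have := hinc t ht.1 s hs.1 hst
        by_contra! hc
        nlinarith [mul_lt_mul_of_pos_left hc hlam]
    have hsub : {t | t ∈ I ∧ |f t| < lam * μ ^ (k + 1)} ⊆
        ({t | t ∈ {t | t ∈ I ∧ lam * μ ≤ g t} ∧ |f t| < lam * μ * μ ^ k} ∪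
          {t | t ∈ {t | t ∈ I ∧ lam * μ ≤ -g t} ∧ |-f t| < lam * μ * μ ^ k}) ∪
          {t | t ∈ I ∧ |g t| < lam * μ} := by
      rintro t ⟨htI, ht⟩
      have ht' : |f t| < lam * μ * μ ^ k := by rwa [mul_assoc, ← pow_succ']
      by_cases hc : |g t| < lam * μ
      · exact Or.inr ⟨htI, hc⟩
      · left
        rcases le_abs.1 (not_lt.1 hc) with hc | hc
        · exact Or.inl ⟨⟨htI, hc⟩, ht'⟩
        · exact Or.inr ⟨⟨htI, hc⟩, by rwa [abs_neg]⟩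
    refine (measure_mono hsub).trans ((measure_union_le _ _).trans
      ((add_le_add ((measure_union_le _ _).trans (add_le_add h1 h2)) h3).trans ?_))
    rw [← ENNReal.ofReal_add (by positivity) (by positivity),
      ← ENNReal.ofReal_add (by positivity) (by positivity)]
    refine ENNReal.ofReal_le_ofReal ?_
    have : (1 : ℝ) ≤ 4 ^ k := one_le_pow₀ (by norm_num)
    rw [pow_succ]
    nlinarith

/-- Near `p` the derivative exceeds half its value at `p`, so the one-dimensional estimate holds on
every vertical slice of a ball, and Tonelli's theorem integrates it in `x`. -/
lemma exists_nhds_volume_sublevel_le_of_pos {S : ℝ × ℝ → ℝ} (hS : ContDiff ℝ ∞ S) {p : ℝ × ℝ}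
    {k : ℕ} (hk : 0 < yDeriv k S p) :
    ∃ N ∈ 𝓝 p, ∃ lam > 0, ∃ C ≥ 0, ∀ μ > 0,
      volume (N ∩ {q | |S q| < lam * μ ^ k}) ≤ ENNReal.ofReal (C * μ) := by
  set lam := yDeriv k S p / 2 with hlam
  have hev : ∀ᶠ q in 𝓝 p, lam < yDeriv k S q :=
    (contDiff_yDeriv hS k).continuous.continuousAt.eventually (lt_mem_nhds (by
      simp only [hlam]; linarith))
  obtain ⟨r, hr, hball⟩ := Metric.eventually_nhds_iff_ball.1 hev
  refine ⟨Metric.ball p r, Metric.ball_mem_nhds p hr, lam, by positivity, 2 * r * 4 ^ k,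
    by positivity, fun μ hμ => ?_⟩
  have hmeas : MeasurableSet (Metric.ball p r ∩ {q | |S q| < lam * μ ^ k}) :=
    (Metric.isOpen_ball.inter (isOpen_lt hS.continuous.abs continuous_const)).measurableSet
  rw [Measure.volume_eq_prod, Measure.prod_apply hmeas]
  calc ∫⁻ x, volume (Prod.mk x ⁻¹' (Metric.ball p r ∩ {q | |S q| < lam * μ ^ k}))
      ≤ ∫⁻ x, (Metric.ball p.1 r).indicator (fun _ => ENNReal.ofReal (4 ^ k * μ)) x := by
        refine lintegral_mono fun x => ?_
        by_cases hx : x ∈ Metric.ball p.1 r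
        · rw [indicator_of_mem hx]
          refine le_trans (measure_mono ?_) (volume_sublevel_le (f := fun y => S (x, y))
            (hS.comp (contDiff_const.prodMk contDiff_id)) k
            (I := Metric.ball p.2 r) (by rw [Real.ball_eq_Ioo]; exact ordConnected_Ioo)
            (lam := lam) (by positivity) hμ fun t ht => ?_)
          · rintro t ⟨ht, ht'⟩
            rw [← ball_prod_same] at ht
            exact ⟨ht.2, ht'⟩
          · refine (hball (x, t) ?_).le
            rw [← ball_prod_same]
            exact ⟨hx, ht⟩
        · have : Prod.mk x ⁻¹' (Metric.ball p r ∩ {q | |S q| < lam * μ ^ k}) = ∅ := by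
            ext t
            simp only [mem_preimage, mem_inter_iff, mem_empty_iff_false, iff_false, not_and]
            intro ht
            rw [← ball_prod_same] at ht
            exact absurd ht.1 hx
          rw [this]; simp
    _ = ENNReal.ofReal (2 * r * 4 ^ k * μ) := by
        rw [lintegral_indicator_const Metric.isOpen_ball.measurableSet, Real.volume_ball,
          ← ENNReal.ofReal_mul (by positivity)]
        congr 1; ring

lemma exists_nhds_volume_sublevel_le {S : ℝ × ℝ → ℝ} (hS : ContDiff ℝ ∞ S) {p : ℝ × ℝ}
    {k : ℕ} (hk : yDeriv k S p ≠ 0) :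
    ∃ N ∈ 𝓝 p, ∃ lam > 0, ∃ C ≥ 0, ∀ μ > 0,
      volume (N ∩ {q | |S q| < lam * μ ^ k}) ≤ ENNReal.ofReal (C * μ) := by
  rcases lt_or_gt_of_ne hk with h | h
  · have h' : 0 < yDeriv k (fun q => -S q) p := by
      have := iteratedDeriv_neg k (fun y => S (p.1, y)) p.2
      change 0 < iteratedDeriv k (-fun y => S (p.1, y)) p.2
      rw [this]
      exact neg_pos.2 h
    simpa only [abs_neg] using exists_nhds_volume_sublevel_le_of_pos hS.neg h'
  · exact exists_nhds_volume_sublevel_le_of_pos hS h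

lemma exists_nhds_volume_sublevel_le' {S : ℝ × ℝ → ℝ} (hS : ContDiff ℝ ∞ S) {p : ℝ × ℝ}
    {k : ℕ} (hk : yDeriv k S p ≠ 0 ∨ xDeriv k S p ≠ 0) :
    ∃ N ∈ 𝓝 p, ∃ lam > 0, ∃ C ≥ 0, ∀ μ > 0,
      volume (N ∩ {q | |S q| < lam * μ ^ k}) ≤ ENNReal.ofReal (C * μ) := by
  rcases hk with hk | hk
  · exact exists_nhds_volume_sublevel_le hS hk
  · rw [xDeriv_eq_yDeriv_swap] at hk
    have hsw : ContDiff ℝ ∞ (Prod.swap : ℝ × ℝ → ℝ × ℝ) := contDiff_snd.prodMk contDiff_fst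
    obtain ⟨N, hN, lam, hlam, C, hC, h⟩ := exists_nhds_volume_sublevel_le (hS.comp hsw) hk
    refine ⟨Prod.swap ⁻¹' N, continuous_swap.continuousAt.preimage_mem_nhds hN, lam, hlam, C, hC,
      fun μ hμ => ?_⟩
    have hmp : MeasurePreserving (MeasurableEquiv.prodComm : ℝ × ℝ ≃ᵐ ℝ × ℝ) volume volume :=
      Measure.measurePreserving_swap
    have := hmp.measure_preimage_equiv (N ∩ {q | |(S ∘ Prod.swap) q| < lam * μ ^ k})
    refine le_trans (le_of_eq ?_) (h μ hμ)
    rw [← this]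
    rfl

/-- If near every point of a compact set some partial derivative of admissible order is nonzero,
then the part of `{|S| < ε}` in this set has measure `o(h ε)`. -/
lemma eventually_volume_inter_sublevel_le {S : ℝ × ℝ → ℝ} (hS : ContDiff ℝ ∞ S) {h : ℝ → ℝ}
    (hh : ∀ᶠ ε in 𝓝[>] (0 : ℝ), 0 < h ε) {K : Set (ℝ × ℝ)} (hK : IsCompact K)
    (hnd : ∀ p ∈ K, ∃ k : ℕ, Tendsto (fun ε => ε / h ε ^ k) (𝓝[>] 0) (𝓝 0) ∧
      (yDeriv k S p ≠ 0 ∨ xDeriv k S p ≠ 0)) {η : ℝ} (hη : 0 < η) :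
    ∀ᶠ ε in 𝓝[>] (0 : ℝ), volume (K ∩ {q | |S q| < ε}) ≤ ENNReal.ofReal (η * h ε) := by
  refine hK.induction_on (p := fun s => ∀ η > 0, ∀ᶠ ε in 𝓝[>] (0 : ℝ),
    volume (s ∩ {q | |S q| < ε}) ≤ ENNReal.ofReal (η * h ε)) ?_ ?_ ?_ ?_ η hη
  · intro η _
    simp
  · intro s t hst ht η hη
    filter_upwards [ht η hη] with ε hε
    exact (measure_mono (inter_subset_inter_left _ hst)).trans hε
  · intro s t hs ht η hη
    filter_upwards [hs (η / 2) (by positivity), ht (η / 2) (by positivity), hh] with ε h1 h2 h3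
    rw [union_inter_distrib_right]
    refine (measure_union_le _ _).trans ((add_le_add h1 h2).trans ?_)
    rw [← ENNReal.ofReal_add (by positivity) (by positivity)]
    refine ENNReal.ofReal_le_ofReal ?_
    linarith
  · intro p hp
    obtain ⟨k, hk, hkp⟩ := hnd p hp
    obtain ⟨N, hN, lam, hlam, C, hC, hb⟩ := exists_nhds_volume_sublevel_le' hS hkp
    refine ⟨N, mem_nhdsWithin_of_mem_nhds hN, fun η hη => ?_⟩
    -- The local estimate is used with `μ = η' * h ε`; as `ε = o(h ε ^ k)`, eventually `ε ≤ lam * μ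
    -- ^ k`, however small `η'` is.
    set η' := η / (C + 1) with hη'
    have hη'0 : 0 < η' := by positivity
    filter_upwards [hh, hk.eventually (gt_mem_nhds (show 0 < lam * η' ^ k by positivity))]
      with ε h1 h2
    have h3 : ε ≤ lam * (η' * h ε) ^ k := by
      rw [div_lt_iff₀ (by positivity)] at h2
      rw [mul_pow, ← mul_assoc]
      exact h2.le
    refine (measure_mono (inter_subset_inter_right _ fun q hq => lt_of_lt_of_le hq h3)).trans
      ((hb (η' * h ε) (by positivity)).trans (ENNReal.ofReal_le_ofReal ?_))
    rw [← mul_assoc]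
    refine mul_le_mul_of_nonneg_right ?_ h1.le
    rw [hη', mul_div_assoc', div_le_iff₀ (by positivity)]
    nlinarith

/-! ### Lower bounds for the measure of sublevel sets -/

/-- If the Taylor support lies in the half-plane `1 ≤ w₁ a + w₂ b`, then `|S| < ε` on the box
`|x| ≤ δ ε ^ w₁`, `|y| ≤ δ ε ^ w₂`, with `δ` uniform in weights that are bounded below. -/
lemma exists_box_subset_sublevel {S : ℝ × ℝ → ℝ} (hS : ContDiff ℝ ∞ S) {η : ℝ} (hη : 0 < η) :
    ∃ δ : ℝ, 0 < δ ∧ δ ≤ 1 ∧ ∀ ε : ℝ, 0 < ε → ε < 1 → ∀ w₁ w₂ : ℝ, η ≤ w₁ → η ≤ w₂ →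
      (∀ a b : ℕ, taylorCoeff S a b ≠ 0 → 1 ≤ w₁ * a + w₂ * b) →
      ∀ x y : ℝ, |x| ≤ δ * ε ^ w₁ → |y| ≤ δ * ε ^ w₂ → |S (x, y)| < ε := by
  -- With `η * N ≥ 1` the remainder monomials `x ^ N` and `y ^ N` also have weight at least 1. As
  -- `N` depends on `η` alone, so do the constants and `δ`.
  obtain ⟨N, hN⟩ := exists_nat_ge (1 / η)
  rw [div_le_iff₀ hη] at hN
  have hN1 : N ≠ 0 := by rintro rfl; simp at hN; linarith
  obtain ⟨C, hC, hT⟩ := exists_abs_pow_mul_yDeriv_sub_le hS (Nat.zero_le N)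
  set B := ∑ ab ∈ Finset.range N ×ˢ Finset.range N, |taylorCoeff S ab.1 ab.2| with hB
  have hB0 : 0 ≤ B := Finset.sum_nonneg fun _ _ => abs_nonneg _
  -- Each relevant monomial is at most `δ * ε`, because weight at least 1 forces `a + b ≥ 1`; hence
  -- `|S| ≤ (B + 2 * C) * δ * ε < ε`.
  set δ := 1 / (B + 2 * C + 1) with hδ
  have hδ0 : 0 < δ := by positivity
  have hδ1 : δ ≤ 1 := by rw [hδ, div_le_one (by positivity)]; linarith
  refine ⟨δ, hδ0, hδ1, fun ε hε hε1 w₁ w₂ hw₁ hw₂ hw x y hx hy => ?_⟩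
  have hle1 : ∀ w, η ≤ w → δ * ε ^ w ≤ 1 := fun w hwη =>
    mul_le_one₀ hδ1 (by positivity) (Real.rpow_le_one hε.le hε1.le (hη.le.trans hwη))
  have hmono : ∀ a b : ℕ, 1 ≤ w₁ * a + w₂ * b → |x| ^ a * |y| ^ b ≤ δ * ε := by
    intro a b hab
    have hne : a + b ≠ 0 := by
      intro h0
      obtain ⟨rfl, rfl⟩ : a = 0 ∧ b = 0 := by omega
      simp at hab
      linarith
    calc |x| ^ a * |y| ^ b ≤ (δ * ε ^ w₁) ^ a * (δ * ε ^ w₂) ^ b := by gcongr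
      _ = δ ^ (a + b) * ε ^ (w₁ * a + w₂ * b) := by
        rw [mul_pow, mul_pow, ← Real.rpow_mul_natCast hε.le, ← Real.rpow_mul_natCast hε.le,
          Real.rpow_add hε]
        ring
      _ ≤ δ * ε := by
        have h1 : δ ^ (a + b) ≤ δ := pow_le_of_le_one hδ0.le hδ1 hne
        have h2 : ε ^ (w₁ * a + w₂ * b) ≤ ε := by
          simpa using Real.rpow_le_rpow_of_exponent_ge hε hε1.le hab
        gcongr
  have hx1 := hx.trans (hle1 w₁ hw₁)
  have hy1 := hy.trans (hle1 w₂ hw₂)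
  have hNx : |x| ^ N ≤ δ * ε := by
    simpa using hmono N 0 (by push_cast; nlinarith [Nat.cast_nonneg (α := ℝ) N])
  have hNy : |y| ^ N ≤ δ * ε := by
    simpa using hmono 0 N (by push_cast; nlinarith [Nat.cast_nonneg (α := ℝ) N])
  have h1 := hT x y hx1 hy1
  simp only [pow_zero, one_mul, Nat.descFactorial_zero, Nat.cast_one, mul_one] at h1
  have h0 : yDeriv 0 S (x, y) = S (x, y) := by simp [yDeriv]
  rw [h0] at h1
  have h2 : |∑ ab ∈ Finset.range N ×ˢ Finset.range N,
      taylorCoeff S ab.1 ab.2 * (x ^ ab.1 * y ^ ab.2)| ≤ B * (δ * ε) := by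
    rw [hB, Finset.sum_mul]
    refine (Finset.abs_sum_le_sum_abs _ _).trans (Finset.sum_le_sum fun ab _ => ?_)
    by_cases hs : taylorCoeff S ab.1 ab.2 = 0
    · simp [hs]
    · rw [abs_mul, abs_mul, abs_pow, abs_pow]
      exact mul_le_mul_of_nonneg_left (hmono _ _ (hw _ _ hs)) (abs_nonneg _)
  have h3 : |S (x, y)| ≤ (B + 2 * C) * (δ * ε) := by
    have := abs_sub_abs_le_abs_sub (S (x, y)) (∑ ab ∈ Finset.range N ×ˢ Finset.range N,
      taylorCoeff S ab.1 ab.2 * (x ^ ab.1 * y ^ ab.2))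
    nlinarith [mul_le_mul_of_nonneg_left (add_le_add hNx hNy) hC]
  refine h3.trans_lt ?_
  rw [hδ, ← mul_assoc, mul_one_div]
  refine mul_lt_of_lt_one_left hε ?_
  rw [div_lt_one (by positivity)]
  linarith

lemma eventually_mul_rpow_lt (δ : ℝ) {w r : ℝ} (hw : 0 < w) (hr : 0 < r) :
    ∀ᶠ ε in 𝓝[>] (0 : ℝ), δ * ε ^ w < r := by
  have h : Tendsto (fun ε : ℝ => δ * ε ^ w) (𝓝[>] 0) (𝓝 (δ * 0 ^ w)) :=
    ((Real.continuousAt_rpow_const 0 w (Or.inr hw.le)).tendsto.const_mul δ).mono_left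
      nhdsWithin_le_nhds
  rw [Real.zero_rpow hw.ne', mul_zero] at h
  exact h.eventually (gt_mem_nhds hr)

lemma eventually_pos_lt_one : ∀ᶠ ε in 𝓝[>] (0 : ℝ), 0 < ε ∧ ε < 1 :=
  Ioo_mem_nhdsGT one_pos

/-- Lower bound for the sublevel sets coming from one supporting half-plane. -/
lemma exists_le_volume_ball_inter_sublevel {S : ℝ × ℝ → ℝ} (hS : ContDiff ℝ ∞ S) {w₁ w₂ : ℝ}
    (hw₁ : 0 < w₁) (hw₂ : 0 < w₂)
    (hw : ∀ a b : ℕ, taylorCoeff S a b ≠ 0 → 1 ≤ w₁ * a + w₂ * b) :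
    ∃ c > 0, ∀ r > 0, ∀ᶠ ε in 𝓝[>] (0 : ℝ),
      ENNReal.ofReal (c * ε ^ (w₁ + w₂)) ≤
        volume (Metric.ball (0 : ℝ × ℝ) r ∩ {q | |S q| < ε}) := by
  obtain ⟨δ, hδ, hδ1, h⟩ := exists_box_subset_sublevel hS (lt_min hw₁ hw₂)
  refine ⟨4 * δ ^ 2, by positivity, fun r hr => ?_⟩
  filter_upwards [eventually_pos_lt_one, eventually_mul_rpow_lt δ hw₁ hr,
    eventually_mul_rpow_lt δ hw₂ hr] with ε ⟨hε, hε1⟩ h1 h2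
  have hsub : Icc (-(δ * ε ^ w₁)) (δ * ε ^ w₁) ×ˢ Icc (-(δ * ε ^ w₂)) (δ * ε ^ w₂) ⊆
      Metric.ball (0 : ℝ × ℝ) r ∩ {q | |S q| < ε} := by
    rintro ⟨x, y⟩ ⟨hx, hy⟩
    have hx' : |x| ≤ δ * ε ^ w₁ := abs_le.2 hx
    have hy' : |y| ≤ δ * ε ^ w₂ := abs_le.2 hy
    refine ⟨?_, h ε hε hε1 w₁ w₂ (min_le_left _ _) (min_le_right _ _) hw x y hx' hy'⟩
    rw [mem_ball_zero_iff, Prod.norm_def]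
    exact max_lt (hx'.trans_lt h1) (hy'.trans_lt h2)
  refine le_trans (le_of_eq ?_) (measure_mono hsub)
  rw [Measure.volume_eq_prod, Measure.prod_prod, Real.volume_Icc, Real.volume_Icc,
    ← ENNReal.ofReal_mul (by have := Real.rpow_pos_of_pos hε w₁; nlinarith), Real.rpow_add hε]
  congr 1; ring

/-- Lower bound for the sublevel sets coming from a one-parameter family of supporting
half-planes through a common point of the bisectrix. -/
lemma exists_le_volume_ball_inter_sublevel_log {S : ℝ × ℝ → ℝ} (hS : ContDiff ℝ ∞ S)
    {s₁ s₂ D : ℝ} (hs₁ : 0 < s₁) (hs : s₁ < s₂) (hs₂ : s₂ < D)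
    (hw : ∀ s, s₁ ≤ s → s ≤ s₂ → ∀ a b : ℕ, taylorCoeff S a b ≠ 0 →
      1 ≤ s * a + (D - s) * b) :
    ∃ c > 0, ∀ r > 0, ∀ᶠ ε in 𝓝[>] (0 : ℝ),
      ENNReal.ofReal (c * (|Real.log ε| * ε ^ D)) ≤
        volume (Metric.ball (0 : ℝ × ℝ) r ∩ {q | |S q| < ε}) := by
  set η := min s₁ (D - s₂) with hη
  have hη0 : 0 < η := lt_min hs₁ (by linarith)
  obtain ⟨δ, hδ, hδ1, h⟩ := exists_box_subset_sublevel hS hη0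
  refine ⟨δ ^ 2 * (s₂ - s₁), mul_pos (by positivity) (by linarith), fun r hr => ?_⟩
  filter_upwards [eventually_pos_lt_one, eventually_mul_rpow_lt δ hη0 hr] with ε ⟨hε, hε1⟩ h1
  have hlog : Real.log ε < 0 := Real.log_neg hε hε1
  set s : Set ℝ := Icc (δ * ε ^ s₂) (δ * ε ^ s₁)
  have hpos : 0 < δ * ε ^ s₂ := by positivity
  have hle : δ * ε ^ s₂ ≤ δ * ε ^ s₁ :=
    mul_le_mul_of_nonneg_left (Real.rpow_le_rpow_of_exponent_ge hε hε1.le hs.le) hδ.le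
  -- A point under the hyperbola `x * y = δ ^ 2 * ε ^ D` with `x = δ * ε ^ t` lies in the box of
  -- weights `(t, D - t)`. The range of `x` is `t ∈ [s₁, s₂]`, and integrating `x⁻¹` over it gives
  -- `(s₂ - s₁) * |log ε|`.
  have hsub : regionBetween (fun _ => 0) (fun x => δ ^ 2 * ε ^ D * x⁻¹) s ⊆
      Metric.ball (0 : ℝ × ℝ) r ∩ {q | |S q| < ε} := by
    rintro ⟨x, y⟩ ⟨hx, hy0, hy⟩
    simp only at hx hy0 hy
    have hx0 : 0 < x := hpos.trans_le hx.1
    set t := Real.log (x / δ) / Real.log ε with ht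
    have hxt : x = δ * ε ^ t := by
      rw [Real.rpow_def_of_pos hε, ht, mul_div_cancel₀ _ hlog.ne, Real.exp_log (by positivity)]
      field_simp
    have ht1 : s₁ ≤ t := by
      have h2 := hx.2
      rw [hxt] at h2
      exact (Real.rpow_le_rpow_left_iff_of_base_lt_one hε hε1).1 (le_of_mul_le_mul_left h2 hδ)
    have ht2 : t ≤ s₂ := by
      have h2 := hx.1
      rw [hxt] at h2
      exact (Real.rpow_le_rpow_left_iff_of_base_lt_one hε hε1).1 (le_of_mul_le_mul_left h2 hδ)
    have hyt : y < δ * ε ^ (D - t) := by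
      refine hy.trans_eq ?_
      rw [hxt, Real.rpow_sub hε]
      have := (Real.rpow_pos_of_pos hε t).ne'
      field_simp
    have e1 : η ≤ t := (min_le_left _ _).trans ht1
    have e2 : η ≤ D - t := (min_le_right _ _).trans (by linarith)
    have hmn : ∀ w, η ≤ w → δ * ε ^ w ≤ δ * ε ^ η := fun w hwη =>
      mul_le_mul_of_nonneg_left (Real.rpow_le_rpow_of_exponent_ge hε hε1.le hwη) hδ.le
    refine ⟨?_, h ε hε hε1 t (D - t) e1 e2 (hw t ht1 ht2) x y ?_ ?_⟩
    · rw [mem_ball_zero_iff, Prod.norm_def]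
      refine max_lt ?_ ?_
      · rw [Real.norm_eq_abs, abs_of_pos hx0, hxt]
        exact (hmn t e1).trans_lt h1
      · rw [Real.norm_eq_abs, abs_of_pos hy0]
        exact hyt.trans_le (hmn _ e2) |>.trans h1
    · rw [abs_of_pos hx0]; exact hxt.le
    · rw [abs_of_pos hy0]; exact hyt.le
  refine le_trans (le_of_eq ?_) (measure_mono hsub)
  have hint : IntegrableOn (fun x => δ ^ 2 * ε ^ D * x⁻¹) s := by
    refine ContinuousOn.integrableOn_Icc (continuousOn_const.mul
      (continuousOn_id.inv₀ fun x hx => (hpos.trans_le hx.1).ne'))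
  rw [Measure.volume_eq_prod, volume_regionBetween_eq_integral integrableOn_zero hint
    measurableSet_Icc fun x hx => by
      have : 0 < x := hpos.trans_le hx.1
      positivity]
  congr 1
  simp only [Pi.sub_apply, sub_zero]
  rw [integral_Icc_eq_integral_Ioc, ← intervalIntegral.integral_of_le hle,
    intervalIntegral.integral_const_mul, integral_inv_of_pos hpos (by positivity),
    mul_div_mul_left _ _ hδ.ne', ← Real.rpow_sub hε, Real.log_rpow hε, abs_of_neg hlog]
  ring

/-! ### The Newton polygon -/

section NewtonPolygon

variable {S : ℝ × ℝ → ℝ}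

lemma mem_newtonPolygon_of_le {a b : ℕ} (h : taylorCoeff S a b ≠ 0) {t : ℝ × ℝ}
    (h1 : (a : ℝ) ≤ t.1) (h2 : (b : ℝ) ≤ t.2) : t ∈ newtonPolygon S :=
  subset_convexHull ℝ _ ⟨a, b, h, h1, h2⟩

lemma le_of_mem_newtonPolygon {w₁ w₂ m : ℝ} (hw₁ : 0 ≤ w₁) (hw₂ : 0 ≤ w₂)
    (h : ∀ a b : ℕ, taylorCoeff S a b ≠ 0 → m ≤ w₁ * a + w₂ * b) {t : ℝ × ℝ}
    (ht : t ∈ newtonPolygon S) : m ≤ w₁ * t.1 + w₂ * t.2 := by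
  have hc : Convex ℝ {t : ℝ × ℝ | m ≤ w₁ * t.1 + w₂ * t.2} := by
    intro x hx y hy a b ha hb hab
    simp only [mem_ofPred_eq, Prod.fst_add, Prod.smul_fst, Prod.snd_add, Prod.smul_snd,
      smul_eq_mul] at hx hy ⊢
    obtain rfl : b = 1 - a := by linarith
    nlinarith [mul_le_mul_of_nonneg_left hx ha, mul_le_mul_of_nonneg_left hy hb]
  refine convexHull_min ?_ hc ht
  rintro t ⟨a, b, hab, h1, h2⟩
  exact (h a b hab).trans (by gcongr)

/-- Translation by the nonnegative vector `u - t` maps the union of quadrants into itself, hence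
also its convex hull. -/
lemma newtonPolygon_upward {t u : ℝ × ℝ} (ht : t ∈ newtonPolygon S) (h1 : t.1 ≤ u.1)
    (h2 : t.2 ≤ u.2) : u ∈ newtonPolygon S := by
  have hsub : newtonPolygon S ⊆ (fun x => (u - t) + x) ⁻¹' newtonPolygon S := by
    refine convexHull_min ?_ ((convex_convexHull ℝ _).translate_preimage_right _)
    rintro x ⟨a, b, hab, hx1, hx2⟩
    refine mem_newtonPolygon_of_le hab ?_ ?_
    · simp only [Prod.fst_add, Prod.fst_sub]; linarith
    · simp only [Prod.snd_add, Prod.snd_sub]; linarith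
  simpa using hsub ht

lemma newtonDistance_le {t : ℝ} (ht : (t, t) ∈ newtonPolygon S) : newtonDistance S ≤ t := by
  refine csInf_le ⟨0, fun u hu => ?_⟩ ht
  have := le_of_mem_newtonPolygon (S := S) (w₁ := 1) (w₂ := 0) (m := 0) (by norm_num) le_rfl
    (fun a b _ => by simp) hu
  simpa using this

/-- The two points lie strictly on opposite sides of the bisectrix; weighting each by the other's
offset `|t₁ - t₂|` gives the crossing point. -/
lemma exists_mem_openSegment_bisectrix {x y : ℝ × ℝ} {s m : ℝ} (hx : x.1 + s * x.2 = m)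
    (hy : y.1 + s * y.2 = m) (h1 : x.1 < x.2) (h2 : y.2 < y.1) :
    ∃ t : ℝ, (t, t) ∈ openSegment ℝ x y ∧ (1 + s) * t = m := by
  obtain ⟨x1, x2⟩ := x
  obtain ⟨y1, y2⟩ := y
  simp only at hx hy h1 h2
  have hα : 0 < x2 - x1 := by linarith
  have hβ : 0 < y1 - y2 := by linarith
  have hs : x2 - x1 + (y1 - y2) ≠ 0 := by positivity
  have e1 : (y1 - y2) / (x2 - x1 + (y1 - y2)) * x1 + (x2 - x1) / (x2 - x1 + (y1 - y2)) * y1 =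
      (y1 - y2) / (x2 - x1 + (y1 - y2)) * x2 + (x2 - x1) / (x2 - x1 + (y1 - y2)) * y2 := by
    field_simp; ring
  have e3 : (y1 - y2) / (x2 - x1 + (y1 - y2)) + (x2 - x1) / (x2 - x1 + (y1 - y2)) = 1 := by
    field_simp; ring
  refine ⟨(y1 - y2) / (x2 - x1 + (y1 - y2)) * x1 + (x2 - x1) / (x2 - x1 + (y1 - y2)) * y1,
    ⟨(y1 - y2) / (x2 - x1 + (y1 - y2)), (x2 - x1) / (x2 - x1 + (y1 - y2)), by positivity,
      by positivity, e3, ?_⟩, ?_⟩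
  · ext
    · simp
    · simp [e1]
  · generalize (y1 - y2) / (x2 - x1 + (y1 - y2)) = A at e1 e3 ⊢
    generalize (x2 - x1) / (x2 - x1 + (y1 - y2)) = B at e1 e3 ⊢
    obtain rfl : B = 1 - A := by linarith
    have : (1 + s) * (A * x1 + (1 - A) * y1) = A * x1 + (1 - A) * y1 + s * (A * x2 + (1 - A) * y2) := by
      rw [← e1]; ring
    rw [this, ← hx]
    have hy' : y1 + s * y2 = x1 + s * x2 := by rw [hx, hy]
    linear_combination (1 - A) * hy'

/-- A line supporting `N(S)` that passes through support points on either side of the bisectrix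
passes through `(d, d)`. -/
lemma newtonDistance_eq_of_supporting (hd : (newtonDistance S, newtonDistance S) ∈ newtonPolygon S)
    {s m : ℝ} (hs : 0 < s) (h : ∀ a b : ℕ, taylorCoeff S a b ≠ 0 → m ≤ a + s * b)
    {x y : ℝ × ℝ} (hxN : x ∈ newtonPolygon S) (hyN : y ∈ newtonPolygon S)
    (hx : x.1 + s * x.2 = m) (hy : y.1 + s * y.2 = m) (h1 : newtonDistance S ≤ x.2)
    (h2 : newtonDistance S ≤ y.1) : (1 + s) * newtonDistance S = m := by
  set d := newtonDistance S
  have hle : m ≤ 1 * d + s * d := le_of_mem_newtonPolygon zero_le_one hs.le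
    (fun a b hab => by simpa using h a b hab) hd
  refine le_antisymm ?_ (by linarith)
  -- If the line passed strictly below `(d, d)`, `x` and `y` would be on opposite sides of the
  -- bisectrix, and their segment would cross it inside `N(S)` at a parameter smaller than `d`.
  by_contra! hlt
  have hx1 : x.1 < d := by nlinarith [mul_le_mul_of_nonneg_left h1 hs.le]
  have hy2 : y.2 < d := by
    by_contra! hc
    nlinarith [mul_le_mul_of_nonneg_left hc hs.le]
  obtain ⟨t, ht, hm⟩ := exists_mem_openSegment_bisectrix hx hy (by linarith) (by linarith)
  have htd : d ≤ t := newtonDistance_le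
    ((convex_convexHull ℝ _).openSegment_subset hxN hyN ht)
  nlinarith

/-- In the first case the edge is cut out by a functional with positive coefficients. -/
lemma exists_weights_of_isCompactEdge {p q : ℝ × ℝ} (he : IsCompactEdge S p q)
    (hd0 : 0 < newtonDistance S)
    (hd : (newtonDistance S, newtonDistance S) ∈ openSegment ℝ p q) :
    ∃ w₁ w₂ : ℝ, 0 < w₁ ∧ 0 < w₂ ∧ (w₁ + w₂) * newtonDistance S = 1 ∧
      (∀ t ∈ newtonPolygon S, 1 ≤ w₁ * t.1 + w₂ * t.2) ∧
      segment ℝ p q = {t | t ∈ newtonPolygon S ∧ w₁ * t.1 + w₂ * t.2 = 1} := by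
  set d := newtonDistance S
  obtain ⟨hpq, hexp⟩ := he
  obtain ⟨l, hl⟩ := hexp ⟨p, left_mem_segment ℝ p q⟩
  have hlin : ∀ t : ℝ × ℝ, l t = l (1, 0) * t.1 + l (0, 1) * t.2 := by
    intro t
    have : t = t.1 • ((1 : ℝ), (0 : ℝ)) + t.2 • ((0 : ℝ), (1 : ℝ)) := by ext <;> simp
    conv_lhs => rw [this]
    rw [map_add, map_smul, map_smul, smul_eq_mul, smul_eq_mul]
    ring
  set l₁ := l (1, 0)
  set l₂ := l (0, 1)
  have hdseg := openSegment_subset_segment ℝ p q hd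
  have hdm := hdseg
  rw [hl] at hdm
  obtain ⟨hdN, hdmax⟩ := hdm
  have hbdd : Bornology.IsBounded (segment ℝ p q) := by
    rw [segment_eq_image ℝ]
    exact (isCompact_Icc.image (by fun_prop)).isBounded
  obtain ⟨R, hR⟩ := hbdd.subset_closedBall (0 : ℝ × ℝ)
  have hR' : ∀ t ∈ segment ℝ p q, |t.1| ≤ R ∧ |t.2| ≤ R := by
    intro t ht
    have := hR ht
    rw [mem_closedBall_zero_iff, Prod.norm_def] at this
    exact ⟨(le_max_left _ _).trans this, (le_max_right _ _).trans this⟩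
  have hR0 : 0 ≤ R := (abs_nonneg _).trans (hR' _ hdseg).1
  -- Since `N(S)` is closed under upward translation, the functional cannot increase in positive
  -- directions.
  have hup : ∀ u v : ℝ, 0 ≤ u → 0 ≤ v → l₁ * u + l₂ * v ≤ 0 := by
    intro u v hu hv
    have := hdmax (d + u, d + v) (newtonPolygon_upward hdN (by simpa) (by simpa))
    rw [hlin, hlin (d, d)] at this
    simp only at this
    linarith
  -- Were it constant in such a direction, the edge would contain a ray; a displacement by `2 * R +
  -- 1` already leaves the ball of radius `R` containing the edge.
  have hno : ∀ u v : ℝ, 0 ≤ u → 0 ≤ v → 1 ≤ u + v → l₁ * u + l₂ * v ≠ 0 := by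
    intro u v hu hv huv h0
    have hmem : (d + (2 * R + 1) * u, d + (2 * R + 1) * v) ∈ segment ℝ p q := by
      rw [hl]
      refine ⟨newtonPolygon_upward hdN ?_ ?_, fun y hy => (hdmax y hy).trans (le_of_eq ?_)⟩
      · simp only [le_add_iff_nonneg_right]; positivity
      · simp only [le_add_iff_nonneg_right]; positivity
      · rw [hlin, hlin (d + _, _)]
        simp only
        linear_combination -(2 * R + 1) * h0
    obtain ⟨h1, h2⟩ := hR' _ hmem
    simp only at h1 h2
    have h1' := (le_abs_self _).trans h1
    have h2' := (le_abs_self _).trans h2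
    nlinarith
  have hl1 : l₁ < 0 := lt_of_le_of_ne (by simpa using hup 1 0 (by norm_num) le_rfl)
    (by simpa using hno 1 0 (by norm_num) le_rfl (by norm_num))
  have hl2 : l₂ < 0 := lt_of_le_of_ne (by simpa using hup 0 1 le_rfl (by norm_num))
    (by simpa using hno 0 1 le_rfl (by norm_num) (by norm_num))
  have hL : l (d, d) < 0 := by rw [hlin]; simp only; nlinarith
  have hLe : (l₁ + l₂) * d = l (d, d) := by rw [hlin]; simp only; ring
  have hform : ∀ t : ℝ × ℝ, l₁ / l (d, d) * t.1 + l₂ / l (d, d) * t.2 = l t / l (d, d) := by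
    intro t
    rw [hlin t]; ring
  refine ⟨l₁ / l (d, d), l₂ / l (d, d), div_pos_of_neg_of_neg hl1 hL, div_pos_of_neg_of_neg hl2 hL,
    ?_, fun t ht => ?_, ?_⟩
  · rw [← add_div, div_mul_eq_mul_div, hLe, div_self hL.ne]
  · rw [hform, le_div_iff_of_neg hL, one_mul]
    exact hdmax t ht
  · ext t
    rw [mem_ofPred_eq, hform, div_eq_one_iff_eq hL.ne, hl]
    constructor
    · rintro ⟨h1, h2⟩
      exact ⟨h1, le_antisymm (hdmax t h1) (h2 _ hdN)⟩
    · rintro ⟨h1, h2⟩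
      exact ⟨h1, fun y hy => by rw [h2]; exact hdmax y hy⟩

/-- An edge with positive weights is neither horizontal nor vertical. If all of `N(S)` lay in `t₂ ≥
d`, both endpoints, which average to `d`, would have `t₂ = d` and so coincide. The exponents found
control the regions near the axes. -/
lemma exists_taylorCoeff_ne_zero_lt_of_openSegment {p q : ℝ × ℝ} (hpq : p ≠ q)
    {w₁ w₂ : ℝ} (hw₁ : 0 < w₁) (hw₂ : 0 < w₂)
    (hseg : segment ℝ p q = {t | t ∈ newtonPolygon S ∧ w₁ * t.1 + w₂ * t.2 = 1})
    (hd : (newtonDistance S, newtonDistance S) ∈ openSegment ℝ p q) :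
    (∃ a b : ℕ, taylorCoeff S a b ≠ 0 ∧ (b : ℝ) < newtonDistance S) ∧
      ∃ a b : ℕ, taylorCoeff S a b ≠ 0 ∧ (a : ℝ) < newtonDistance S := by
  set d := newtonDistance S
  have hp := left_mem_segment ℝ p q
  have hq := right_mem_segment ℝ p q
  rw [hseg] at hp hq
  obtain ⟨hpN, hp⟩ := hp
  obtain ⟨hqN, hq⟩ := hq
  obtain ⟨α, β, hα, hβ, hαβ, hcomb⟩ := hd
  have hc1 : α * p.1 + β * q.1 = d := by simpa using congrArg Prod.fst hcomb
  have hc2 : α * p.2 + β * q.2 = d := by simpa using congrArg Prod.snd hcomb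
  have hsq : ∀ u v : ℝ, d ≤ u → d ≤ v → α * u + β * v = d → u = d ∧ v = d := by
    intro u v hu hv h
    obtain rfl : β = 1 - α := by linarith
    constructor <;> nlinarith
  constructor
  · by_contra! hc
    have hN : ∀ t ∈ newtonPolygon S, d ≤ 0 * t.1 + 1 * t.2 := fun t ht =>
      le_of_mem_newtonPolygon le_rfl zero_le_one (fun a b hab => by simpa using hc a b hab) ht
    obtain ⟨e1, e2⟩ := hsq p.2 q.2 (by simpa using hN p hpN) (by simpa using hN q hqN) hc2
    refine hpq (Prod.ext ?_ (e1.trans e2.symm))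
    rw [e1] at hp
    rw [e2] at hq
    exact mul_left_cancel₀ hw₁.ne' (by linarith)
  · by_contra! hc
    have hN : ∀ t ∈ newtonPolygon S, d ≤ 1 * t.1 + 0 * t.2 := fun t ht =>
      le_of_mem_newtonPolygon zero_le_one le_rfl (fun a b hab => by simpa using hc a b hab) ht
    obtain ⟨e1, e2⟩ := hsq p.1 q.1 (by simpa using hN p hpN) (by simpa using hN q hqN) hc1
    refine hpq (Prod.ext (e1.trans e2.symm) ?_)
    rw [e1] at hp
    rw [e2] at hq
    exact mul_left_cancel₀ hw₂.ne' (by linarith)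

/-- A line `t₁ + s t₂ = m` through `(d, d)` supporting `N(S)` contains the edge through `(d, d)`,
and meets `N(S)` in this edge only. -/
lemma mem_segment_iff_of_supporting {p q : ℝ × ℝ} (hpq : p ≠ q)
    {w₁ w₂ : ℝ} (hwd : (w₁ + w₂) * newtonDistance S = 1)
    (hseg : segment ℝ p q = {t | t ∈ newtonPolygon S ∧ w₁ * t.1 + w₂ * t.2 = 1})
    (hd : (newtonDistance S, newtonDistance S) ∈ openSegment ℝ p q)
    {s m : ℝ} (hs : 0 < s) (h : ∀ a b : ℕ, taylorCoeff S a b ≠ 0 → m ≤ a + s * b)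
    (hm : (1 + s) * newtonDistance S = m) {t : ℝ × ℝ} (ht : t ∈ newtonPolygon S) :
    t ∈ segment ℝ p q ↔ t.1 + s * t.2 = m := by
  set d := newtonDistance S
  have hp := left_mem_segment ℝ p q
  have hq := right_mem_segment ℝ p q
  rw [hseg] at hp hq
  obtain ⟨hpN, hp⟩ := hp
  obtain ⟨hqN, hq⟩ := hq
  obtain ⟨α, β, hα, hβ, hαβ, hcomb⟩ := hd
  have hc1 : α * p.1 + β * q.1 = d := by simpa using congrArg Prod.fst hcomb
  have hc2 : α * p.2 + β * q.2 = d := by simpa using congrArg Prod.snd hcomb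
  have hN : ∀ t ∈ newtonPolygon S, m ≤ t.1 + s * t.2 := fun t ht => by
    simpa using le_of_mem_newtonPolygon zero_le_one hs.le
      (fun a b hab => by simpa using h a b hab) ht
  have hsum : α * (p.1 + s * p.2) + β * (q.1 + s * q.2) = m := by
    rw [← hm, add_mul, one_mul]
    nth_rw 1 [← hc1]
    rw [← hc2]; ring
  have hp' : p.1 + s * p.2 = m := by
    obtain rfl : β = 1 - α := by linarith
    nlinarith [hN p hpN, mul_le_mul_of_nonneg_left (hN q hqN) hβ.le]
  have hq' : q.1 + s * q.2 = m := by
    obtain rfl : β = 1 - α := by linarith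
    nlinarith [hN q hqN, mul_le_mul_of_nonneg_left (hN p hpN) hα.le]
  -- Both functionals are constant on the nondegenerate segment from `p` to `q`, hence proportional.
  have hw : w₂ = s * w₁ := by
    have h1 : (p.2 - q.2) * (w₂ - s * w₁) = 0 := by
      linear_combination hp - hq - w₁ * hp' + w₁ * hq'
    rcases mul_eq_zero.1 h1 with h1 | h1
    · refine absurd (Prod.ext ?_ (sub_eq_zero.1 h1)) hpq
      linear_combination hp' - hq' - s * h1
    · linarith
  have hw1 : w₁ * m = 1 := by
    rw [← hm]; linear_combination hwd - newtonDistance S * hw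
  have hw0 : w₁ ≠ 0 := by rintro rfl; simp at hw1
  rw [hseg, mem_ofPred_eq, hw]
  constructor
  · rintro ⟨-, h2⟩
    refine mul_left_cancel₀ hw0 ?_
    rw [hw1, ← h2]; ring
  · intro h2
    refine ⟨ht, ?_⟩
    rw [← hw1, ← h2]; ring

/-- If `(d, d)` is a vertex then it is a point of the Taylor support, and the other points of the
support do not lie weakly below it. -/
lemma exists_taylorCoeff_ne_zero_of_vertex (h : NewtonCaseTwo S) :
    ∃ n : ℕ, newtonDistance S = n ∧ taylorCoeff S n n ≠ 0 ∧
      ∀ a b : ℕ, taylorCoeff S a b ≠ 0 → (a < n → n < b) ∧ (b < n → n < a) := by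
  set d := newtonDistance S with hd
  have hN : ∀ v : ℝ × ℝ, (d, d) - v ∈ newtonPolygon S → (d, d) + v ∈ newtonPolygon S → v = 0 := by
    intro v h1 h2
    have := (mem_extremePoints.1 h).2 _ h1 _ h2 (mem_openSegment_sub_add _ v)
    exact add_eq_left.1 this.2
  -- The reflection through `(d, d)` of a support point weakly below it dominates that point, so it
  -- lies in `N(S)` as well, and extremality collapses the two.
  have h1 : ∀ a b : ℕ, taylorCoeff S a b ≠ 0 → (a : ℝ) ≤ d → (b : ℝ) ≤ d → (a : ℝ) = d ∧ (b : ℝ) = d := by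
    intro a b hab ha hb
    have := hN (d - a, d - b) (mem_newtonPolygon_of_le hab (by simp) (by simp))
      (mem_newtonPolygon_of_le hab (by simp only [Prod.mk_add_mk]; linarith)
        (by simp only [Prod.mk_add_mk]; linarith))
    have e1 : d - a = 0 := congrArg Prod.fst this
    have e2 : d - b = 0 := congrArg Prod.snd this
    exact ⟨by linarith, by linarith⟩
  obtain ⟨a, b, hab, ha, hb⟩ := extremePoints_convexHull_subset h
  obtain ⟨e1, e2⟩ := h1 a b hab ha hb
  have e3 : a = b := by exact_mod_cast e1.trans e2.symm
  subst e3
  refine ⟨a, e1.symm, hab, fun a' b' h' => ⟨fun hlt => ?_, fun hlt => ?_⟩⟩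
  · by_contra! hc
    have := (h1 a' b' h' (by rw [← e1]; exact_mod_cast hlt.le) (by rw [← e1]; exact_mod_cast hc)).1
    rw [← e1] at this
    exact hlt.ne (by exact_mod_cast this)
  · by_contra! hc
    have := (h1 a' b' h' (by rw [← e1]; exact_mod_cast hc) (by rw [← e1]; exact_mod_cast hlt.le)).2
    rw [← e1] at this
    exact hlt.ne (by exact_mod_cast this)

/-- A vertex on the bisectrix has a non-degenerate interval of supporting lines. -/
lemma exists_interval_weights_of_vertex (h : NewtonCaseTwo S) (hd0 : 0 < newtonDistance S) :
    ∃ s₁ s₂ : ℝ, 0 < s₁ ∧ s₁ < s₂ ∧ s₂ < 1 / newtonDistance S ∧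
      ∀ s, s₁ ≤ s → s ≤ s₂ → ∀ a b : ℕ, taylorCoeff S a b ≠ 0 →
        1 ≤ s * a + (1 / newtonDistance S - s) * b := by
  obtain ⟨n, hn, hnn, hsep⟩ := exists_taylorCoeff_ne_zero_of_vertex h
  have hext := (mem_extremePoints.1 h).2
  rw [hn] at hd0
  have hn0 : 0 < n := by exact_mod_cast hd0
  -- In terms of `u = s * n` the goal is `n ≤ u * a + (1 - u) * b`. If `u` and `1 - u` are at least
  -- `n / M`, this is automatic once `a ≥ M` or `b ≥ M`, leaving finitely many constraints. The size
  -- of `M` gives `n / M < 1 / (n + 1)`, a lower bound for every upper constraint in `hi`.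
  set M : ℕ := n * (n + 1) + 1 with hM
  have hMr : (M : ℝ) = n * (n + 1) + 1 := by rw [hM]; push_cast; ring
  have hM0 : (0 : ℝ) < M := by rw [hMr]; positivity
  have hn1 : (1 : ℝ) ≤ n := by exact_mod_cast hn0
  have hnM : (n : ℝ) / M < 1 / (n + 1) := by
    rw [div_lt_div_iff₀ hM0 (by positivity), hMr]; linarith
  have hhalf : (1 : ℝ) / (n + 1) ≤ 1 / 2 := one_div_le_one_div_of_le (by norm_num) (by linarith)
  classical
  set F := (Finset.range M ×ˢ Finset.range M).filter fun ab => taylorCoeff S ab.1 ab.2 ≠ 0 with hF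
  set lo : Finset ℝ := insert ((n : ℝ) / M)
    ((F.filter fun ab => ab.2 < n).image fun ab => ((n : ℝ) - ab.2) / (ab.1 - ab.2)) with hlo
  set hi : Finset ℝ := insert (1 - (n : ℝ) / M)
    ((F.filter fun ab => ab.1 < n).image fun ab => ((ab.2 : ℝ) - n) / (ab.2 - ab.1)) with hhi
  have hlohi : ∀ x ∈ lo, ∀ y ∈ hi, x < y := by
    intro x hx y hy
    rw [hlo, Finset.mem_insert, Finset.mem_image] at hx
    rw [hhi, Finset.mem_insert, Finset.mem_image] at hy
    rcases hx with rfl | ⟨⟨a, b⟩, hx, rfl⟩ <;> rcases hy with rfl | ⟨⟨a', b'⟩, hy, rfl⟩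
    · linarith
    · simp only [Finset.mem_filter, hF] at hy
      have h1 := (hsep a' b' hy.1.2).1 hy.2
      have h1' : (n : ℝ) + 1 ≤ b' := by exact_mod_cast h1
      have h2' : (a' : ℝ) < n := by exact_mod_cast hy.2
      refine hnM.trans_le ?_
      rw [div_le_div_iff₀ (by positivity) (by linarith)]
      have h3' : (0 : ℝ) ≤ a' := Nat.cast_nonneg _
      nlinarith
    · simp only [Finset.mem_filter, hF] at hx
      have h1 := (hsep a b hx.1.2).2 hx.2
      have h1' : (n : ℝ) + 1 ≤ a := by exact_mod_cast h1
      have h2' : (b : ℝ) < n := by exact_mod_cast hx.2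
      have h3' : (0 : ℝ) ≤ b := Nat.cast_nonneg _
      have : ((n : ℝ) - b) / (a - b) ≤ 1 - 1 / (n + 1) := by
        rw [div_le_iff₀ (by linarith), one_sub_div (by positivity), div_mul_eq_mul_div,
          le_div_iff₀ (by positivity)]
        nlinarith
      simp only
      linarith
    · simp only [Finset.mem_filter, hF] at hx hy
      have h1 := (hsep a b hx.1.2).2 hx.2
      have h2 := (hsep a' b' hy.1.2).1 hy.2
      have r1 : (n : ℝ) < a := by exact_mod_cast h1
      have r2 : (b : ℝ) < n := by exact_mod_cast hx.2
      have r3 : (n : ℝ) < b' := by exact_mod_cast h2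
      have r4 : (a' : ℝ) < n := by exact_mod_cast hy.2
      simp only
      -- If a lower constraint reached an upper one, the segment between the two support points
      -- would meet the bisectrix at or below `(n, n)`: below contradicts the minimality of `d`, at
      -- it the extremality.
      by_contra! hc
      rw [div_le_div_iff₀ (by linarith) (by linarith)] at hc
      have hα : (0 : ℝ) < b' - a' := by linarith
      have hβ : (0 : ℝ) < a - b := by linarith
      set σ : ℝ := (b' - a') + (a - b) with hσ
      have hσ0 : 0 < σ := by positivity
      have hmem : (((b' - a') * a + (a - b) * a') / σ, ((b' - a') * a + (a - b) * a') / σ) ∈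
          openSegment ℝ ((a : ℝ), (b : ℝ)) ((a' : ℝ), (b' : ℝ)) := by
        refine ⟨(b' - a') / σ, (a - b) / σ, by positivity, by positivity, ?_, ?_⟩
        · rw [← add_div, div_self hσ0.ne']
        · ext
          · simp only [Prod.fst_add, Prod.smul_fst, smul_eq_mul]; ring
          · simp only [Prod.snd_add, Prod.smul_snd, smul_eq_mul]; field_simp; ring
      have m1 : ((a : ℝ), (b : ℝ)) ∈ newtonPolygon S := mem_newtonPolygon_of_le hx.1.2 le_rfl le_rfl
      have m2 : ((a' : ℝ), (b' : ℝ)) ∈ newtonPolygon S :=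
        mem_newtonPolygon_of_le hy.1.2 le_rfl le_rfl
      have hge := newtonDistance_le
        ((convex_convexHull ℝ _).openSegment_subset m1 m2 hmem)
      have hle : ((b' - a') * a + (a - b) * a') / σ ≤ (n : ℝ) := by
        rw [div_le_iff₀ hσ0, hσ]; nlinarith
      rw [← hn] at hle
      rw [le_antisymm hle hge] at hmem
      have := congrArg Prod.fst (hext _ m1 _ m2 hmem).1
      simp only [hn] at this
      linarith
  obtain ⟨u₁, hu1, hu1'⟩ := Order.exists_between_finsets lo hi hlohi
  obtain ⟨u₂, hu2, hu2'⟩ := Order.exists_between_finsets {u₁} hi (by simpa using hu1')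
  have hu12 : u₁ < u₂ := hu2 u₁ (by simp)
  have b1 : (n : ℝ) / M < u₁ := hu1 _ (by simp [hlo])
  have b2 : u₂ < 1 - (n : ℝ) / M := hu2' _ (by simp [hhi])
  have b0 : (0 : ℝ) < n / M := by positivity
  refine ⟨u₁ / n, u₂ / n, div_pos (by linarith) hd0, by gcongr, ?_, fun s hs1 hs2 a b hab => ?_⟩
  · rw [hn]; gcongr; linarith
  · rw [hn]
    rw [div_le_iff₀ hd0] at hs1
    rw [le_div_iff₀ hd0] at hs2
    set u := s * n with hu
    suffices hsuff : (n : ℝ) ≤ u * a + (1 - u) * b by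
      have e : s * a + (1 / n - s) * b = (u * a + (1 - u) * b) / n := by
        rw [hu]; field_simp
      rw [e, le_div_iff₀ hd0, one_mul]
      exact hsuff
    have hu0 : 0 < u := by linarith
    have hu1 : 0 < 1 - u := by linarith
    have ha0 : (0 : ℝ) ≤ a := Nat.cast_nonneg _
    have hb0 : (0 : ℝ) ≤ b := Nat.cast_nonneg _
    have hlow : (n : ℝ) ≤ u * M := by
      rw [← div_le_iff₀ hM0]; linarith
    have hhigh : (n : ℝ) ≤ (1 - u) * M := by
      rw [← div_le_iff₀ hM0]; linarith
    rcases le_or_gt M a with hMa | hMa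
    · have : (M : ℝ) ≤ a := by exact_mod_cast hMa
      nlinarith [mul_le_mul_of_nonneg_left this hu0.le, mul_nonneg hu1.le hb0]
    rcases le_or_gt M b with hMb | hMb
    · have : (M : ℝ) ≤ b := by exact_mod_cast hMb
      nlinarith [mul_le_mul_of_nonneg_left this hu1.le, mul_nonneg hu0.le ha0]
    have habF : (a, b) ∈ F := by simp [hF, hMa, hMb, hab]
    rcases lt_or_ge b n with hbn | hbn
    · have r1 : (n : ℝ) < a := by exact_mod_cast (hsep a b hab).2 hbn
      have r2 : (b : ℝ) < n := by exact_mod_cast hbn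
      have : ((n : ℝ) - b) / (a - b) < u₁ := by
        refine ‹∀ x ∈ lo, x < u₁› _ ?_
        rw [hlo, Finset.mem_insert, Finset.mem_image]
        exact Or.inr ⟨(a, b), by simp [habF, hbn], rfl⟩
      rw [div_lt_iff₀ (by linarith)] at this
      nlinarith [mul_le_mul_of_nonneg_right hs1 (show (0 : ℝ) ≤ a - b by linarith)]
    rcases lt_or_ge a n with han | han
    · have r1 : (n : ℝ) < b := by exact_mod_cast (hsep a b hab).1 han
      have r2 : (a : ℝ) < n := by exact_mod_cast han
      have : u₂ < ((b : ℝ) - n) / (b - a) := by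
        refine hu2' _ ?_
        rw [hhi, Finset.mem_insert, Finset.mem_image]
        exact Or.inr ⟨(a, b), by simp [habF, han], rfl⟩
      rw [lt_div_iff₀ (by linarith)] at this
      nlinarith [mul_le_mul_of_nonneg_right hs2 (show (0 : ℝ) ≤ b - a by linarith)]
    have r1 : (n : ℝ) ≤ a := by exact_mod_cast han
    have r2 : (n : ℝ) ≤ b := by exact_mod_cast hbn
    nlinarith [mul_le_mul_of_nonneg_left r1 hu0.le, mul_le_mul_of_nonneg_left r2 hu1.le]

/-- In the third case one of the coordinates is at least `d` on the Taylor support. -/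
lemma newtonDistance_le_of_caseThree (h : NewtonCaseThree S) :
    (∀ a b : ℕ, taylorCoeff S a b ≠ 0 → newtonDistance S ≤ b) ∨
      ∀ a b : ℕ, taylorCoeff S a b ≠ 0 → newtonDistance S ≤ a := by
  set d := newtonDistance S
  have hlin : ∀ (l : ℝ × ℝ →L[ℝ] ℝ) (t : ℝ × ℝ), l t = l (1, 0) * t.1 + l (0, 1) * t.2 := by
    intro l t
    have : t = t.1 • ((1 : ℝ), (0 : ℝ)) + t.2 • ((0 : ℝ), (1 : ℝ)) := by ext <;> simp
    conv_lhs => rw [this]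
    rw [map_add, map_smul, map_smul, smul_eq_mul, smul_eq_mul]
    ring
  obtain ⟨c, -, hexp | hexp⟩ := h
  · left
    intro a b hab
    obtain ⟨l, hl⟩ := hexp ⟨(c, d), le_rfl, rfl⟩
    have h0 : (c, d) ∈ {t : ℝ × ℝ | c ≤ t.1 ∧ t.2 = d} := ⟨le_rfl, rfl⟩
    have h1 : (c + 1, d) ∈ {t : ℝ × ℝ | c ≤ t.1 ∧ t.2 = d} := ⟨by simp, rfl⟩
    rw [hl] at h0 h1
    -- The functional is constant along the ray but not maximal above it, so it is a negative
    -- multiple of the second coordinate.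
    have e1 := le_antisymm (h0.2 _ h1.1) (h1.2 _ h0.1)
    have hup : (c, d + 1) ∈ newtonPolygon S := newtonPolygon_upward h0.1 le_rfl (by simp)
    have e2 := h0.2 _ hup
    rw [hlin l (c, d), hlin l (c + 1, d)] at e1
    rw [hlin l (c, d), hlin l (c, d + 1)] at e2
    simp only at e1 e2
    have l1 : l (1, 0) = 0 := by linarith
    have l2 : l (0, 1) ≠ 0 := by
      intro l2
      have : (c, d + 1) ∈ {t : ℝ × ℝ | c ≤ t.1 ∧ t.2 = d} := by
        rw [hl]
        exact ⟨hup, fun y _ => by rw [hlin l y, hlin l (c, d + 1), l1, l2]; simp⟩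
      have := this.2
      simp at this
    have l2' : l (0, 1) < 0 := lt_of_le_of_ne (by linarith) l2
    have := h0.2 _ (mem_newtonPolygon_of_le (t := ((a : ℝ), (b : ℝ))) hab le_rfl le_rfl)
    rw [hlin l (c, d), hlin l (a, b), l1] at this
    simp only at this
    nlinarith
  · right
    intro a b hab
    obtain ⟨l, hl⟩ := hexp ⟨(d, c), rfl, le_rfl⟩
    have h0 : (d, c) ∈ {t : ℝ × ℝ | t.1 = d ∧ c ≤ t.2} := ⟨rfl, le_rfl⟩
    have h1 : (d, c + 1) ∈ {t : ℝ × ℝ | t.1 = d ∧ c ≤ t.2} := ⟨rfl, by simp⟩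
    rw [hl] at h0 h1
    have e1 := le_antisymm (h0.2 _ h1.1) (h1.2 _ h0.1)
    have hup : (d + 1, c) ∈ newtonPolygon S := newtonPolygon_upward h0.1 (by simp) le_rfl
    have e2 := h0.2 _ hup
    rw [hlin l (d, c), hlin l (d, c + 1)] at e1
    rw [hlin l (d, c), hlin l (d + 1, c)] at e2
    simp only at e1 e2
    have l1 : l (0, 1) = 0 := by linarith
    have l2 : l (1, 0) ≠ 0 := by
      intro l2
      have : (d + 1, c) ∈ {t : ℝ × ℝ | t.1 = d ∧ c ≤ t.2} := by
        rw [hl]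
        exact ⟨hup, fun y _ => by rw [hlin l y, hlin l (d + 1, c), l1, l2]; simp⟩
      have := this.1
      simp at this
    have l2' : l (1, 0) < 0 := lt_of_le_of_ne (by linarith) l2
    have := h0.2 _ (mem_newtonPolygon_of_le (t := ((a : ℝ), (b : ℝ))) hab le_rfl le_rfl)
    rw [hlin l (d, c), hlin l (a, b), l1] at this
    simp only at this
    nlinarith

end NewtonPolygon

/-! ### Non-degeneracy of `S` away from the origin -/

/-- In a region `|y| ≤ |x| ^ K` the derivative `∂_y ^ b S` does not vanish if some `x ^ a y ^ b`
occurs in the Taylor expansion. -/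
lemma exists_yDeriv_ne_zero_of_abs_le_pow {S : ℝ × ℝ → ℝ} (hS : ContDiff ℝ ∞ S) {b : ℕ}
    (hb : ∃ a, taylorCoeff S a b ≠ 0) :
    ∃ K : ℕ, ∀ᶠ p : ℝ × ℝ in 𝓝 0, p.1 ≠ 0 → |p.2| ≤ |p.1| ^ K → yDeriv b S p ≠ 0 := by
  classical
  set a₀ := Nat.find hb with ha₀
  have hne : taylorCoeff S a₀ b ≠ 0 := Nat.find_spec hb
  have hmin : ∀ i < a₀, taylorCoeff S i b = 0 := fun i hi => not_not.1 (Nat.find_min hb hi)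
  -- By minimality of `a₀`, `∂_y ^ b S = L * x ^ a₀ + O(|x| ^ (a₀ + 1) + |y|)`; for `|y| ≤ |x| ^ (a₀
  -- + 1)` the main term wins near 0.
  obtain ⟨C, hC, hT⟩ := exists_abs_sub_taylor_two_le (contDiff_yDeriv hS b) (a₀ + 1) 1
  set L := taylorCoeff (yDeriv b S) a₀ 0 with hL
  have hL0 : L ≠ 0 := by
    rw [hL, taylorCoeff_yDeriv, zero_add, Nat.descFactorial_self]
    exact mul_ne_zero hne (by exact_mod_cast b.factorial_ne_zero)
  have hLpos : 0 < |L| := abs_pos.2 hL0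
  have hsum : ∀ x y : ℝ, ∑ i ∈ Finset.range (a₀ + 1), ∑ j ∈ Finset.range 1,
      taylorCoeff (yDeriv b S) i j * x ^ i * y ^ j = L * x ^ a₀ := by
    intro x y
    rw [Finset.sum_range_succ, Finset.sum_eq_zero fun i hi => ?_]
    · simp [hL]
    · rw [Finset.sum_range_one, taylorCoeff_yDeriv, zero_add, hmin i (Finset.mem_range.1 hi)]
      simp
  refine ⟨a₀ + 1, ?_⟩
  set r := min 1 (|L| / (2 * C + 1)) with hr
  have hr0 : 0 < r := lt_min one_pos (by positivity)
  filter_upwards [Metric.ball_mem_nhds (0 : ℝ × ℝ) hr0] with p hp hp1 hp2 h0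
  rw [mem_ball_zero_iff, Prod.norm_def, max_lt_iff, Real.norm_eq_abs, Real.norm_eq_abs] at hp
  have hx : |p.1| < |L| / (2 * C + 1) := hp.1.trans_le (min_le_right _ _)
  have h1 := hT p.1 p.2 (hp.1.le.trans (min_le_left _ _)) (hp.2.le.trans (min_le_left _ _))
  rw [hsum, Prod.mk.eta, h0, zero_sub, abs_neg, abs_mul, abs_pow, pow_one] at h1
  have hx0 : 0 < |p.1| := abs_pos.2 hp1
  have hxa : 0 < |p.1| ^ a₀ := by positivity
  rw [lt_div_iff₀ (by positivity)] at hx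
  have h2 : |L| * |p.1| ^ a₀ ≤ 2 * C * |p.1| * |p.1| ^ a₀ := by
    rw [pow_succ] at h1 hp2
    nlinarith
  have h3 := le_of_mul_le_mul_right h2 hxa
  nlinarith

/-! ### Limits of monomials along an ultrafilter -/

/-- Compactness in place of repeated passage to subsequences: all bounded quantities converge along
the same ultrafilter. -/
lemma Ultrafilter.exists_tendsto_of_mem_Icc {α : Type*} (u : Ultrafilter α) {f : α → ℝ} {l r : ℝ}
    (h : ∀ᶠ p in (u : Filter α), f p ∈ Icc l r) :
    ∃ c ∈ Icc l r, Tendsto f (u : Filter α) (𝓝 c) :=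
  isCompact_Icc.ultrafilter_le_nhds' (u.map f) h

/-- Along an ultrafilter on which `X, Y → 0` at polynomially comparable rates, one of finitely many
monomials `X ^ a Y ^ b` dominates, and the monomials comparable to it lie on a line. -/
lemma exists_dominating_monomial {α : Type*} (u : Ultrafilter α) {X Y : α → ℝ} {K : ℕ}
    (hK : 0 < K) (hX : ∀ᶠ p in (u : Filter α), 0 < X p ∧ X p < 1)
    (hY : ∀ᶠ p in (u : Filter α), 0 < Y p ∧ Y p < 1) (hX0 : Tendsto X u (𝓝 0))
    (hXY : ∀ᶠ p in (u : Filter α), X p ^ K ≤ Y p ∧ Y p ^ K ≤ X p) {F : Finset (ℕ × ℕ)}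
    (hF : F.Nonempty) :
    ∃ e ∈ F, ∃ s : ℝ, 0 < s ∧ 1 ≤ s * K ∧ s ≤ K ∧ ∃ c : ℕ × ℕ → ℝ,
      (∀ᶠ p in (u : Filter α), ∀ v ∈ F, X p ^ v.1 * Y p ^ v.2 ≤ X p ^ e.1 * Y p ^ e.2) ∧
      (∀ v ∈ F, Tendsto (fun p => X p ^ v.1 * Y p ^ v.2 / (X p ^ e.1 * Y p ^ e.2)) u (𝓝 (c v))) ∧
      c e = 1 ∧ (∀ v ∈ F, (e.1 : ℝ) + s * e.2 ≤ v.1 + s * v.2) ∧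
      (∀ v ∈ F, c v ≠ 0 → (v.1 : ℝ) + s * v.2 = e.1 + s * e.2) ∧
      ∀ w ∈ F, c w ≠ 0 → w ≠ e → 0 < c w ∧ ∀ v ∈ F, (v.1 : ℝ) + s * v.2 = e.1 + s * e.2 →
        c v = c w ^ (((v.2 : ℝ) - e.2) / ((w.2 : ℝ) - e.2)) := by
  obtain ⟨e, he, hdom⟩ := (Ultrafilter.eventually_exists_mem_iff (f := u) (is := (F : Set (ℕ × ℕ)))
    (P := fun e p => ∀ v ∈ F, X p ^ v.1 * Y p ^ v.2 ≤ X p ^ e.1 * Y p ^ e.2) F.finite_toSet).1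
    (Eventually.of_forall fun p =>
      Finset.exists_max_image F (fun v => X p ^ v.1 * Y p ^ v.2) hF)
  -- Thus `Y = X ^ lam`, and the limit `s` of `lam` fixes the slope of the supporting line.
  set lam : α → ℝ := fun p => Real.log (Y p) / Real.log (X p) with hlam
  have hlamIcc : ∀ᶠ p in (u : Filter α), lam p ∈ Icc (1 / (K : ℝ)) K := by
    filter_upwards [hX, hY, hXY] with p hx hy hxy
    have hlx : Real.log (X p) < 0 := Real.log_neg hx.1 hx.2
    have hly : Real.log (Y p) < 0 := Real.log_neg hy.1 hy.2
    have h1 := Real.log_le_log (pow_pos hx.1 K) hxy.1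
    have h2 := Real.log_le_log (pow_pos hy.1 K) hxy.2
    rw [Real.log_pow] at h1 h2
    refine ⟨?_, (div_le_iff_of_neg hlx).2 h1⟩
    rw [hlam, le_div_iff_of_neg hlx, one_div, ← div_eq_inv_mul, le_div_iff₀ (by positivity)]
    linarith
  obtain ⟨s, hs, hlams⟩ := u.exists_tendsto_of_mem_Icc hlamIcc
  have hKr : (0 : ℝ) < K := by exact_mod_cast hK
  have hs0 : 0 < s := lt_of_lt_of_le (by positivity) hs.1
  have hcl : ∀ v, ∃ c : ℝ, v ∈ F →
      Tendsto (fun p => X p ^ v.1 * Y p ^ v.2 / (X p ^ e.1 * Y p ^ e.2)) u (𝓝 c) := by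
    intro v
    by_cases hv : v ∈ F
    · obtain ⟨c, -, hc⟩ := u.exists_tendsto_of_mem_Icc
        (f := fun p => X p ^ v.1 * Y p ^ v.2 / (X p ^ e.1 * Y p ^ e.2)) (l := 0) (r := 1) (by
          filter_upwards [hX, hY, hdom] with p hx hy hd
          have := hx.1
          have := hy.1
          exact ⟨by positivity, (div_le_one (by positivity)).2 (hd v hv)⟩)
      exact ⟨c, fun _ => hc⟩
    · exact ⟨0, fun h => absurd h hv⟩
  choose c hc using hcl
  have hlogX : Tendsto (fun p => Real.log (X p)) u atBot :=
    Real.tendsto_log_nhdsGT_zero.comp (tendsto_nhdsWithin_iff.2 ⟨hX0, hX.mono fun _ h => h.1⟩)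
  have hlog : ∀ᶠ p in (u : Filter α), ∀ v : ℕ × ℕ,
      Real.log (X p ^ v.1 * Y p ^ v.2 / (X p ^ e.1 * Y p ^ e.2)) =
        (((v.1 : ℝ) - e.1) + lam p * ((v.2 : ℝ) - e.2)) * Real.log (X p) := by
    filter_upwards [hX, hY] with p hx hy v
    have hlx : Real.log (X p) ≠ 0 := (Real.log_neg hx.1 hx.2).ne
    have := hx.1
    have := hy.1
    rw [Real.log_div (by positivity) (by positivity), Real.log_mul (by positivity) (by positivity),
      Real.log_mul (by positivity) (by positivity), Real.log_pow, Real.log_pow, Real.log_pow,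
      Real.log_pow]
    simp only [hlam]
    field_simp
    ring
  have hexp : ∀ v : ℕ × ℕ, Tendsto (fun p => ((v.1 : ℝ) - e.1) + lam p * ((v.2 : ℝ) - e.2)) u
      (𝓝 (((v.1 : ℝ) - e.1) + s * ((v.2 : ℝ) - e.2))) := fun v =>
    (hlams.mul_const _).const_add _
  -- A nonzero limit bounds the logarithm of the quotient while `log X → -∞`, so the exponent of `X`
  -- must tend to 0.
  have hline : ∀ v ∈ F, c v ≠ 0 → (v.1 : ℝ) + s * v.2 = e.1 + s * e.2 := by
    intro v hv hcv
    have h1 := (hc v hv).log hcv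
    have h2 := h1.mul (tendsto_inv_atBot_zero.comp hlogX)
    rw [mul_zero] at h2
    have h3 := tendsto_nhds_unique (h2.congr' (f₂ := fun p => ((v.1 : ℝ) - e.1) +
      lam p * ((v.2 : ℝ) - e.2)) (by
        filter_upwards [hlog, hX] with p hp hx
        have hlx : Real.log (X p) ≠ 0 := (Real.log_neg hx.1 hx.2).ne
        simp only [hp v, Function.comp]
        field_simp)) (hexp v)
    linarith
  have hce : c e = 1 := by
    refine tendsto_nhds_unique (hc e he) (tendsto_const_nhds.congr' ?_)
    filter_upwards [hX, hY] with p hx hy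
    have := hx.1
    have := hy.1
    rw [div_self (by positivity)]
  refine ⟨e, he, s, hs0, ?_, hs.2, c, hdom, hc, hce, ?_, hline, ?_⟩
  · have := mul_le_mul_of_nonneg_right hs.1 hKr.le
    rwa [one_div, inv_mul_cancel₀ hKr.ne'] at this
  · intro v hv
    have : 0 ≤ ((v.1 : ℝ) - e.1) + s * ((v.2 : ℝ) - e.2) := by
      refine ge_of_tendsto (hexp v) ?_
      filter_upwards [hlog, hX, hY, hdom] with p hp hx hy hd
      have hlx : Real.log (X p) < 0 := Real.log_neg hx.1 hx.2
      have := hx.1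
      have := hy.1
      have h1 : Real.log (X p ^ v.1 * Y p ^ v.2 / (X p ^ e.1 * Y p ^ e.2)) ≤ 0 :=
        Real.log_nonpos (by positivity) ((div_le_one (by positivity)).2 (hd v hv))
      rw [hp v] at h1
      exact nonneg_of_mul_nonpos_left h1 hlx
    linarith
  · intro w hw hcw hwe
    have hcw0 : 0 ≤ c w := by
      refine ge_of_tendsto (hc w hw) ?_
      filter_upwards [hX, hY] with p hx hy
      have := hx.1
      have := hy.1
      positivity
    refine ⟨lt_of_le_of_ne hcw0 hcw.symm, fun v hv hvl => ?_⟩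
    have hwl := hline w hw hcw
    have hw2 : (w.2 : ℝ) - e.2 ≠ 0 := by
      intro h0
      have e2 : (w.2 : ℝ) = e.2 := sub_eq_zero.1 h0
      have e1 : (w.1 : ℝ) = e.1 := by rw [e2] at hwl; linarith
      exact hwe (Prod.ext (by exact_mod_cast e1) (by exact_mod_cast e2))
    refine tendsto_nhds_unique (hc v hv) (((hc w hw).rpow_const (Or.inl hcw)).congr' ?_)
    filter_upwards [hlog, hX, hY] with p hp hx hy
    have := hx.1
    have := hy.1
    rw [← Real.exp_log (show 0 < X p ^ v.1 * Y p ^ v.2 / (X p ^ e.1 * Y p ^ e.2) by positivity),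
      Real.rpow_def_of_pos (by positivity), hp v, hp w]
    congr 1
    -- On the line the quotient for `v` is `X ^ ((lam - s) * (v.2 - e.2))`, so all these quotients
    -- are powers of the one for `w`.
    have e1 : (v.1 : ℝ) - e.1 = -s * ((v.2 : ℝ) - e.2) := by linarith
    have e2 : (w.1 : ℝ) - e.1 = -s * ((w.2 : ℝ) - e.2) := by linarith
    rw [e1, e2]
    field_simp

/-- If all partial derivatives of admissible order vanish along an ultrafilter tending to the origin
within `|x| ^ K ≤ |y| ≤ |x| ^ (1 / K)`, then some polynomial `S_e(±1, y)`, with `e` a supporting line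
of `N(S)`, has a zero of inadmissible order, and similarly in the first variable. -/
lemma exists_degenerate_supporting_line {S : ℝ × ℝ → ℝ} (hS : ContDiff ℝ ∞ S)
    (hTaylor : ∃ a b : ℕ, taylorCoeff S a b ≠ 0) {P : ℕ → Prop} (hP0 : P 0) {D : ℕ}
    (hPD : ∀ k, P k → k ≤ D) {K : ℕ} (hK : 0 < K) (u : Ultrafilter (ℝ × ℝ))
    (hu : (u : Filter (ℝ × ℝ)) ≤ 𝓝 0)
    (hne : ∀ᶠ p : ℝ × ℝ in u, p.1 ≠ 0 ∧ p.2 ≠ 0)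
    (hXY : ∀ᶠ p : ℝ × ℝ in u, |p.1| ^ K ≤ |p.2| ∧ |p.2| ^ K ≤ |p.1|)
    (hbad : ∀ᶠ p : ℝ × ℝ in u, ∀ k, P k → yDeriv k S p = 0 ∧ xDeriv k S p = 0) :
    ∃ s : ℝ, 0 < s ∧ ∃ m sg r : ℝ, (sg = 1 ∨ sg = -1) ∧ r ≠ 0 ∧ ∃ T : Finset (ℕ × ℕ),
      T.Nonempty ∧ (∀ v, v ∈ T ↔ taylorCoeff S v.1 v.2 ≠ 0 ∧ (v.1 : ℝ) + s * v.2 = m) ∧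
      (∀ a b : ℕ, taylorCoeff S a b ≠ 0 → m ≤ a + s * b) ∧
      ∀ k, P k →
        ∑ v ∈ T, taylorCoeff S v.1 v.2 * sg ^ v.1 * r ^ v.2 * (v.2.descFactorial k : ℝ) = 0 ∧
        ∑ v ∈ T, taylorCoeff S v.1 v.2 * sg ^ v.1 * r ^ v.2 * (v.1.descFactorial k : ℝ) = 0 := by
  classical
  obtain ⟨a', b', hab'⟩ := hTaylor
  -- This makes `X ^ N` and `Y ^ N` at most `X` resp. `Y` times `X ^ a' * Y ^ b'`, so Taylor
  -- remainders are negligible against the dominating monomial; it also exceeds every admissible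
  -- order.
  set N : ℕ := D + K * (a' + b') + 1 with hN
  have hN1 : K * a' + b' + 1 ≤ N := by
    rw [hN, mul_add]; nlinarith [Nat.zero_le D, Nat.mul_le_mul_right b' hK]
  have hN2 : a' + K * b' + 1 ≤ N := by
    rw [hN, mul_add]; nlinarith [Nat.zero_le D, Nat.mul_le_mul_right a' hK]
  have hNa : a' < N := by nlinarith [Nat.zero_le (K * b')]
  have hNb : b' < N := by nlinarith [Nat.zero_le (K * a')]
  set F := (Finset.range N ×ˢ Finset.range N).filter fun v => taylorCoeff S v.1 v.2 ≠ 0 with hF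
  have hF' : (a', b') ∈ F := by simp [hF, hNa, hNb, hab']
  set X : ℝ × ℝ → ℝ := fun p => |p.1| with hXdef
  set Y : ℝ × ℝ → ℝ := fun p => |p.2| with hYdef
  have hX0 : Tendsto X u (𝓝 0) := by
    have : Tendsto X (𝓝 0) (𝓝 (X 0)) := continuous_fst.abs.tendsto 0
    simpa [hXdef] using this.mono_left hu
  have hY0 : Tendsto Y u (𝓝 0) := by
    have : Tendsto Y (𝓝 0) (𝓝 (Y 0)) := continuous_snd.abs.tendsto 0
    simpa [hYdef] using this.mono_left hu
  have hX : ∀ᶠ p in (u : Filter (ℝ × ℝ)), 0 < X p ∧ X p < 1 := by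
    filter_upwards [hne, hX0.eventually (gt_mem_nhds one_pos)] with p h1 h2
    exact ⟨abs_pos.2 h1.1, h2⟩
  have hY : ∀ᶠ p in (u : Filter (ℝ × ℝ)), 0 < Y p ∧ Y p < 1 := by
    filter_upwards [hne, hY0.eventually (gt_mem_nhds one_pos)] with p h1 h2
    exact ⟨abs_pos.2 h1.2, h2⟩
  obtain ⟨e, he, s, hs, hsK, hsK', c, hdom, hc, hce, hmin, hline, hmult⟩ :=
    exists_dominating_monomial u hK hX hY hX0 hXY ⟨_, hF'⟩
  have hsign : ∀ f : ℝ × ℝ → ℝ, ∃ sg : ℝ, (sg = 1 ∨ sg = -1) ∧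
      ∀ᶠ p in (u : Filter (ℝ × ℝ)), f p = sg * |f p| := by
    intro f
    have : ∀ᶠ p in (u : Filter (ℝ × ℝ)), f p = 1 * |f p| ∨ f p = -1 * |f p| :=
      Eventually.of_forall fun p => by
        rcases abs_choice (f p) with h | h <;> rw [h] <;> simp
    rcases Ultrafilter.eventually_or.1 this with h | h
    · exact ⟨1, Or.inl rfl, h⟩
    · exact ⟨-1, Or.inr rfl, h⟩
  obtain ⟨sg, hsg, hsgX⟩ := hsign Prod.fst
  obtain ⟨τ, hτ, hτY⟩ := hsign Prod.snd
  have hsg0 : sg ≠ 0 := by rcases hsg with rfl | rfl <;> norm_num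
  have hτ0 : τ ≠ 0 := by rcases hτ with rfl | rfl <;> norm_num
  -- the limits of the normalised Taylor expansions of the derivatives
  have hlim : ∀ (f : ℕ × ℕ → ℝ), (∃ C : ℝ, ∀ᶠ p : ℝ × ℝ in u,
      |∑ v ∈ Finset.range N ×ˢ Finset.range N,
        taylorCoeff S v.1 v.2 * f v * (p.1 ^ v.1 * p.2 ^ v.2)| ≤ C * (X p ^ N + Y p ^ N)) →
      ∑ v ∈ F, taylorCoeff S v.1 v.2 * f v * (sg ^ v.1 * τ ^ v.2 * c v) = 0 := by
    rintro f ⟨C, hC⟩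
    have h1 : Tendsto (fun p : ℝ × ℝ => ∑ v ∈ F, taylorCoeff S v.1 v.2 * f v *
        (sg ^ v.1 * τ ^ v.2 * (X p ^ v.1 * Y p ^ v.2 / (X p ^ e.1 * Y p ^ e.2)))) u
        (𝓝 (∑ v ∈ F, taylorCoeff S v.1 v.2 * f v * (sg ^ v.1 * τ ^ v.2 * c v))) :=
      tendsto_finsetSum _ fun v hv => ((hc v hv).const_mul _).const_mul _
    have h2 : Tendsto (fun p => |C| * (X p + Y p)) u (𝓝 0) := by
      simpa using (hX0.add hY0).const_mul |C|
    refine tendsto_nhds_unique h1 (squeeze_zero_norm' ?_ h2)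
    filter_upwards [hX, hY, hdom, hC, hsgX, hτY, hXY] with p hx hy hd hCp e1 e2 hxy
    have hx0 := hx.1
    have hy0 := hy.1
    have hM0 : 0 < X p ^ e.1 * Y p ^ e.2 := by positivity
    have hsum : ∑ v ∈ F, taylorCoeff S v.1 v.2 * f v *
        (sg ^ v.1 * τ ^ v.2 * (X p ^ v.1 * Y p ^ v.2 / (X p ^ e.1 * Y p ^ e.2))) =
        (∑ v ∈ Finset.range N ×ˢ Finset.range N,
          taylorCoeff S v.1 v.2 * f v * (p.1 ^ v.1 * p.2 ^ v.2)) / (X p ^ e.1 * Y p ^ e.2) := by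
      rw [Finset.sum_div, hF, Finset.sum_filter]
      refine Finset.sum_congr rfl fun v _ => ?_
      split_ifs with h
      · have e1' : p.1 = sg * X p := e1
        have e2' : p.2 = τ * Y p := e2
        rw [e1', e2']
        have hX' : X (sg * X p, τ * Y p) = X p := by rw [← e1', ← e2']
        have hY' : Y (sg * X p, τ * Y p) = Y p := by rw [← e1', ← e2']
        rw [mul_pow, mul_pow]
        ring
      · rw [not_not.1 h]; simp
    rw [hsum, Real.norm_eq_abs, abs_div, abs_of_pos hM0, div_le_iff₀ hM0]
    have hM := hd _ hF'
    simp only at hM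
    have b1 : X p ^ N ≤ X p * (X p ^ e.1 * Y p ^ e.2) := by
      calc X p ^ N ≤ X p ^ (a' + K * b' + 1) := pow_le_pow_of_le_one hx0.le hx.2.le hN2
        _ = X p * (X p ^ a' * (X p ^ K) ^ b') := by rw [← pow_mul]; ring
        _ ≤ X p * (X p ^ a' * Y p ^ b') := by gcongr; exact hxy.1
        _ ≤ _ := by gcongr
    have b2 : Y p ^ N ≤ Y p * (X p ^ e.1 * Y p ^ e.2) := by
      calc Y p ^ N ≤ Y p ^ (K * a' + b' + 1) := pow_le_pow_of_le_one hy0.le hy.2.le hN1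
        _ = Y p * ((Y p ^ K) ^ a' * Y p ^ b') := by rw [← pow_mul]; ring
        _ ≤ Y p * (X p ^ a' * Y p ^ b') := by gcongr; exact hxy.2
        _ ≤ _ := by gcongr
    calc _ ≤ C * (X p ^ N + Y p ^ N) := hCp
      _ ≤ |C| * (X p ^ N + Y p ^ N) := by gcongr; exact le_abs_self C
      _ ≤ |C| * (X p * (X p ^ e.1 * Y p ^ e.2) + Y p * (X p ^ e.1 * Y p ^ e.2)) := by gcongr
      _ = _ := by ring
  have hzero : ∀ k, P k →
      ∑ v ∈ F, taylorCoeff S v.1 v.2 * (v.2.descFactorial k : ℝ) * (sg ^ v.1 * τ ^ v.2 * c v) = 0 ∧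
      ∑ v ∈ F, taylorCoeff S v.1 v.2 * (v.1.descFactorial k : ℝ) * (sg ^ v.1 * τ ^ v.2 * c v) = 0 := by
    intro k hk
    have hkN : k ≤ N := (hPD k hk).trans (by rw [hN]; omega)
    constructor
    · refine hlim (fun v => (v.2.descFactorial k : ℝ)) ?_
      obtain ⟨C, -, hC⟩ := exists_abs_pow_mul_yDeriv_sub_le hS hkN
      refine ⟨C, ?_⟩
      filter_upwards [hX, hY, hbad] with p hx hy hb
      have := hC p.1 p.2 hx.2.le hy.2.le
      rw [Prod.mk.eta, (hb k hk).1, mul_zero, zero_sub, abs_neg] at this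
      exact this
    · refine hlim (fun v => (v.1.descFactorial k : ℝ)) ?_
      have hsw : ContDiff ℝ ∞ (Prod.swap : ℝ × ℝ → ℝ × ℝ) := contDiff_snd.prodMk contDiff_fst
      obtain ⟨C, -, hC⟩ := exists_abs_pow_mul_yDeriv_sub_le (hS.comp hsw) hkN
      refine ⟨C, ?_⟩
      filter_upwards [hX, hY, hbad] with p hx hy hb
      have := hC p.2 p.1 hy.2.le hx.2.le
      rw [show yDeriv k (S ∘ Prod.swap) (p.2, p.1) = xDeriv k S p from rfl, (hb k hk).2,
        mul_zero, zero_sub, abs_neg, add_comm] at this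
      refine le_trans (le_of_eq ?_) this
      congr 1
      rw [Finset.sum_product_right, Finset.sum_product]
      refine Finset.sum_congr rfl fun i _ => Finset.sum_congr rfl fun j _ => ?_
      rw [taylorCoeff_swap hS, mul_comm (p.1 ^ _)]
  -- a second monomial comparable with the dominating one
  obtain ⟨w, hw, hcw, hwe⟩ : ∃ w ∈ F, c w ≠ 0 ∧ w ≠ e := by
    -- If only `e` had a nonzero limit, the relation for `k = 0` would say that its Taylor
    -- coefficient vanishes.
    by_contra! hcon
    have h0 := (hzero 0 hP0).1
    rw [Finset.sum_eq_single_of_mem e he fun v hv hve => by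
      by_cases hcv : c v = 0
      · simp [hcv]
      · exact absurd (hcon v hv hcv) hve] at h0
    have hes : taylorCoeff S e.1 e.2 ≠ 0 := (Finset.mem_filter.1 he).2
    rw [hce] at h0
    simp [hes, hsg0, hτ0] at h0
  obtain ⟨hcw0, hcv⟩ := hmult w hw hcw hwe
  -- On the line `c v = ρ ^ (v.2 - e.2)`, so the limiting sums are those of the line's polynomial at
  -- `r = τ * ρ`, up to the factor `ρ ^ e.2`.
  set ρ : ℝ := c w ^ (1 / ((w.2 : ℝ) - e.2)) with hρ
  have hρ0 : 0 < ρ := Real.rpow_pos_of_pos hcw0 _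
  have hcρ : ∀ v ∈ F, (v.1 : ℝ) + s * v.2 = e.1 + s * e.2 → c v = ρ ^ v.2 / ρ ^ e.2 := by
    intro v hv hvl
    rw [hcv v hv hvl, ← Real.rpow_natCast ρ, ← Real.rpow_natCast ρ, ← Real.rpow_sub hρ0, hρ,
      ← Real.rpow_mul hcw0.le]
    congr 1
    ring
  have hFs : ∀ a b : ℕ, taylorCoeff S a b ≠ 0 → (e.1 : ℝ) + s * e.2 ≤ a + s * b ∧
      ((a : ℝ) + s * b = e.1 + s * e.2 → (a, b) ∈ F) := by
    intro a b hab
    by_cases habF : (a, b) ∈ F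
    · exact ⟨hmin _ habF, fun _ => habF⟩
    · have hlt : (e.1 : ℝ) + s * e.2 < a + s * b := by
        have h1 : (e.1 : ℝ) + s * e.2 ≤ a' + s * b' := hmin _ hF'
        have hN1r : (K : ℝ) * a' + b' + 1 ≤ N := by exact_mod_cast hN1
        have hN2r : (a' : ℝ) + K * b' + 1 ≤ N := by exact_mod_cast hN2
        have ha0 : (0 : ℝ) ≤ a := Nat.cast_nonneg _
        have hb0 : (0 : ℝ) ≤ b := Nat.cast_nonneg _
        have ha0' : (0 : ℝ) ≤ a' := Nat.cast_nonneg _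
        have hb0' : (0 : ℝ) ≤ b' := Nat.cast_nonneg _
        have hor : N ≤ a ∨ N ≤ b := by
          by_contra! hcon
          exact habF (by simp [hF, hcon.1, hcon.2, hab])
        rcases hor with h | h
        · have h' : (N : ℝ) ≤ a := by exact_mod_cast h
          nlinarith [mul_le_mul_of_nonneg_right hsK' hb0', mul_nonneg hs.le hb0]
        · have h' : (N : ℝ) ≤ b := by exact_mod_cast h
          nlinarith [mul_le_mul_of_nonneg_left (hN1r.trans h') hs.le,
            mul_le_mul_of_nonneg_right hsK ha0']
      exact ⟨hlt.le, fun h => absurd h hlt.ne'⟩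
  refine ⟨s, hs, e.1 + s * e.2, sg, τ * ρ, hsg, mul_ne_zero hτ0 hρ0.ne',
    F.filter (fun v => (v.1 : ℝ) + s * v.2 = e.1 + s * e.2), ⟨e, by simp [he]⟩, fun v => ?_,
    fun a b hab => (hFs a b hab).1, fun k hk => ?_⟩
  · rw [Finset.mem_filter]
    constructor
    · rintro ⟨h1, h2⟩
      exact ⟨(Finset.mem_filter.1 h1).2, h2⟩
    · rintro ⟨h1, h2⟩
      exact ⟨(hFs v.1 v.2 h1).2 h2, h2⟩
  · have key : ∀ f : ℕ × ℕ → ℝ,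
        ∑ v ∈ F, taylorCoeff S v.1 v.2 * f v * (sg ^ v.1 * τ ^ v.2 * c v) = 0 →
        ∑ v ∈ F.filter (fun v => (v.1 : ℝ) + s * v.2 = e.1 + s * e.2),
          taylorCoeff S v.1 v.2 * sg ^ v.1 * (τ * ρ) ^ v.2 * f v = 0 := by
      intro f hf
      rw [Finset.sum_filter]
      have : ∀ v ∈ F, (if (v.1 : ℝ) + s * v.2 = e.1 + s * e.2 then
          taylorCoeff S v.1 v.2 * sg ^ v.1 * (τ * ρ) ^ v.2 * f v else 0) =
          ρ ^ e.2 * (taylorCoeff S v.1 v.2 * f v * (sg ^ v.1 * τ ^ v.2 * c v)) := by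
        intro v hv
        split_ifs with h
        · rw [hcρ v hv h, mul_pow]
          field_simp
        · have : c v = 0 := by
            by_contra hcv
            exact h (hline v hv hcv)
          rw [this]; simp
      rw [Finset.sum_congr rfl this, ← Finset.mul_sum, hf, mul_zero]
    exact ⟨key _ (hzero k hk).1, key _ (hzero k hk).2⟩

/-- Criterion for some partial derivative of admissible order to be nonzero at every point of a
punctured neighborhood of the origin. -/
lemma eventually_exists_deriv_ne_zero {S : ℝ × ℝ → ℝ} (hS : ContDiff ℝ ∞ S) {P : ℕ → Prop}
    (hP0 : P 0) {D : ℕ} (hPD : ∀ k, P k → k ≤ D)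
    (hy : ∃ a b : ℕ, taylorCoeff S a b ≠ 0 ∧ P b) (hx : ∃ a b : ℕ, taylorCoeff S a b ≠ 0 ∧ P a)
    (H : ∀ s : ℝ, 0 < s → ∀ m sg r : ℝ, (sg = 1 ∨ sg = -1) → r ≠ 0 → ∀ T : Finset (ℕ × ℕ),
      T.Nonempty → (∀ v, v ∈ T ↔ taylorCoeff S v.1 v.2 ≠ 0 ∧ (v.1 : ℝ) + s * v.2 = m) →
      (∀ a b : ℕ, taylorCoeff S a b ≠ 0 → m ≤ a + s * b) →
      ¬ ∀ k, P k →
        ∑ v ∈ T, taylorCoeff S v.1 v.2 * sg ^ v.1 * r ^ v.2 * (v.2.descFactorial k : ℝ) = 0 ∧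
        ∑ v ∈ T, taylorCoeff S v.1 v.2 * sg ^ v.1 * r ^ v.2 * (v.1.descFactorial k : ℝ) = 0) :
    ∀ᶠ p : ℝ × ℝ in 𝓝[≠] 0, ∃ k, P k ∧ (yDeriv k S p ≠ 0 ∨ xDeriv k S p ≠ 0) := by
  by_contra hcon
  have hfr : ∃ᶠ p : ℝ × ℝ in 𝓝[≠] 0, ∀ k, P k → yDeriv k S p = 0 ∧ xDeriv k S p = 0 := by
    intro h
    refine hcon (h.mono fun p hp => ?_)
    by_contra! hc
    exact hp hc
  have := frequently_iff_neBot.1 hfr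
  obtain ⟨u, hu⟩ := exists_ultrafilter_le
    (𝓝[≠] (0 : ℝ × ℝ) ⊓ 𝓟 {p | ∀ k, P k → yDeriv k S p = 0 ∧ xDeriv k S p = 0})
  have hbad : ∀ᶠ p : ℝ × ℝ in u, ∀ k, P k → yDeriv k S p = 0 ∧ xDeriv k S p = 0 :=
    (hu.trans inf_le_right) (mem_principal_self _)
  have hu' : (u : Filter (ℝ × ℝ)) ≤ 𝓝[≠] 0 := hu.trans inf_le_left
  have hne0 : ∀ᶠ p : ℝ × ℝ in u, p ≠ 0 := hu' self_mem_nhdsWithin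
  have hu0 : (u : Filter (ℝ × ℝ)) ≤ 𝓝 0 := hu'.trans nhdsWithin_le_nhds
  obtain ⟨a₁, b₁, h₁, hb₁⟩ := hy
  obtain ⟨a₂, b₂, h₂, ha₂⟩ := hx
  have hsw : ContDiff ℝ ∞ (Prod.swap : ℝ × ℝ → ℝ × ℝ) := contDiff_snd.prodMk contDiff_fst
  obtain ⟨K₁, hK₁⟩ := exists_yDeriv_ne_zero_of_abs_le_pow hS ⟨a₁, h₁⟩
  obtain ⟨K₂, hK₂⟩ := exists_yDeriv_ne_zero_of_abs_le_pow (hS.comp hsw) (b := a₂)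
    ⟨b₂, by rwa [taylorCoeff_swap hS]⟩
  have hK₂' : ∀ᶠ p : ℝ × ℝ in 𝓝 0, p.2 ≠ 0 → |p.1| ≤ |p.2| ^ K₂ → xDeriv a₂ S p ≠ 0 := by
    have : Tendsto (Prod.swap : ℝ × ℝ → ℝ × ℝ) (𝓝 0) (𝓝 0) := continuous_swap.tendsto 0
    exact this.eventually hK₂
  set K := max 1 (max K₁ K₂)
  have hlt : ∀ᶠ p : ℝ × ℝ in u, |p.1| ≤ 1 ∧ |p.2| ≤ 1 := by
    filter_upwards [hu0 (Metric.closedBall_mem_nhds 0 one_pos)] with p hp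
    rw [mem_closedBall_zero_iff, Prod.norm_def] at hp
    exact ⟨(le_max_left _ _).trans hp, (le_max_right _ _).trans hp⟩
  -- Near either axis one of the admissible orders `b₁`, `a₂` gives a nonzero derivative, so the
  -- ultrafilter avoids both regions, and with them the axes.
  have hmid : ∀ᶠ p : ℝ × ℝ in u, (p.1 ≠ 0 ∧ p.2 ≠ 0) ∧ |p.1| ^ K ≤ |p.2| ∧ |p.2| ^ K ≤ |p.1| := by
    filter_upwards [hbad, hne0, hu0 hK₁, hu0 hK₂', hlt] with p hb h0 hk1 hk2 hl
    have c1 : p.1 ≠ 0 → |p.1| ^ K < |p.2| := by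
      intro hp
      by_contra! hc
      exact hk1 hp (hc.trans (pow_le_pow_of_le_one (abs_nonneg _) hl.1
        ((le_max_left _ _).trans (le_max_right _ _)))) (hb _ hb₁).1
    have c2 : p.2 ≠ 0 → |p.2| ^ K < |p.1| := by
      intro hp
      by_contra! hc
      exact hk2 hp (hc.trans (pow_le_pow_of_le_one (abs_nonneg _) hl.2
        ((le_max_right _ _).trans (le_max_right _ _)))) (hb _ ha₂).2
    have d1 : p.1 ≠ 0 := by
      intro hp
      have hp2 : p.2 ≠ 0 := fun hp2 => h0 (Prod.ext hp hp2)
      have := c2 hp2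
      rw [hp, abs_zero] at this
      exact absurd this (not_lt.2 (by positivity))
    have d2 : p.2 ≠ 0 := by
      intro hp
      have := c1 d1
      rw [hp, abs_zero] at this
      exact absurd this (not_lt.2 (by positivity))
    exact ⟨⟨d1, d2⟩, (c1 d1).le, (c2 d2).le⟩
  obtain ⟨s, hs, m, sg, r, hsg, hr, T, hT, hT1, hT2, hT3⟩ :=
    exists_degenerate_supporting_line hS ⟨a₁, b₁, h₁⟩ hP0 hPD (K := K)
      (lt_of_lt_of_le one_pos (le_max_left _ _)) u hu0 (hmid.mono fun _ h => h.1)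
      (hmid.mono fun _ h => h.2) hbad
  exact H s hs m sg r hsg hr T hT hT1 hT2 hT3

/-! ### Zeros of the edge polynomials -/

/-- If `∑ eᵥ (f v) (f v - 1) ⋯ (f v - k + 1)` vanishes for all admissible `k`, then some exponent
`f v` is inadmissible. -/
lemma exists_mem_not_of_sum_descFactorial_eq_zero {ι : Type*} {T : Finset ι} (hT : T.Nonempty)
    {e : ι → ℝ} (he : ∀ v ∈ T, e v ≠ 0) {f : ι → ℕ} (hf : InjOn f T) {P : ℕ → Prop}
    (h : ∀ k, P k → ∑ v ∈ T, e v * ((f v).descFactorial k : ℝ) = 0) : ∃ v ∈ T, ¬ P (f v) := by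
  obtain ⟨v, hv, hmax⟩ := T.exists_max_image f hT
  refine ⟨v, hv, fun hP => ?_⟩
  -- For `k` the largest exponent, the descending factorials of all smaller exponents vanish and a
  -- single nonzero term remains.
  have := h _ hP
  rw [Finset.sum_eq_single_of_mem v hv fun w hw hwv => by
    have hlt : f w < f v := lt_of_le_of_ne (hmax w hw) fun h => hwv (hf hw hv h)
    rw [Nat.descFactorial_of_lt hlt]; simp, Nat.descFactorial_self] at this
  exact mul_ne_zero (he v hv) (by exact_mod_cast (f v).factorial_ne_zero) this

/-- As `s > 0`, either coordinate determines a point of the line, so the preceding argument applies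
in both variables. The two points found let the line be compared with `(d, d)`. -/
lemma exists_inadmissible_of_degenerate {S : ℝ × ℝ → ℝ} {P : ℕ → Prop} {s m sg r : ℝ} (hs : 0 < s)
    (hsg : sg = 1 ∨ sg = -1) (hr : r ≠ 0) {T : Finset (ℕ × ℕ)} (hT : T.Nonempty)
    (hT1 : ∀ v, v ∈ T ↔ taylorCoeff S v.1 v.2 ≠ 0 ∧ (v.1 : ℝ) + s * v.2 = m)
    (h : ∀ k, P k →
        ∑ v ∈ T, taylorCoeff S v.1 v.2 * sg ^ v.1 * r ^ v.2 * (v.2.descFactorial k : ℝ) = 0 ∧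
        ∑ v ∈ T, taylorCoeff S v.1 v.2 * sg ^ v.1 * r ^ v.2 * (v.1.descFactorial k : ℝ) = 0) :
    (∃ v ∈ T, ¬ P v.2) ∧ ∃ v ∈ T, ¬ P v.1 := by
  have hsg0 : sg ≠ 0 := by rcases hsg with rfl | rfl <;> norm_num
  have he : ∀ v ∈ T, taylorCoeff S v.1 v.2 * sg ^ v.1 * r ^ v.2 ≠ 0 := fun v hv =>
    mul_ne_zero (mul_ne_zero ((hT1 v).1 hv).1 (pow_ne_zero _ hsg0)) (pow_ne_zero _ hr)
  constructor
  · refine exists_mem_not_of_sum_descFactorial_eq_zero hT he ?_ fun k hk => (h k hk).1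
    intro v hv w hw hvw
    have e1 := ((hT1 v).1 hv).2
    have e2 := ((hT1 w).1 hw).2
    rw [hvw] at e1
    refine Prod.ext ?_ hvw
    have : (v.1 : ℝ) = w.1 := by linarith
    exact_mod_cast this
  · refine exists_mem_not_of_sum_descFactorial_eq_zero hT he ?_ fun k hk => (h k hk).2
    intro v hv w hw hvw
    have e1 := ((hT1 v).1 hv).2
    have e2 := ((hT1 w).1 hw).2
    rw [hvw] at e1
    refine Prod.ext hvw ?_
    have : (v.2 : ℝ) = w.2 := mul_left_cancel₀ hs.ne' (by linarith)
    exact_mod_cast this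

/-- Converts vanishing sums with descending factorials into vanishing derivatives of the edge
polynomial at `r`. -/
lemma pow_mul_eval_iterate_derivative_monomial (n k : ℕ) (c r : ℝ) :
    r ^ k * (derivative^[k] (monomial n c)).eval r = c * r ^ n * (n.descFactorial k : ℝ) := by
  rw [← C_mul_X_pow_eq_monomial, iterate_derivative_C_mul,
    iterate_derivative_X_pow_eq_natCast_mul]
  simp only [eval_mul, eval_C, eval_natCast, eval_pow, eval_X]
  rcases lt_or_ge n k with h | h
  · rw [Nat.descFactorial_of_lt h]; simp
  · conv_rhs => rw [← Nat.sub_add_cancel h, pow_add, Nat.sub_add_cancel h]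
    ring

lemma edgePoly_eq_sum {S : ℝ × ℝ → ℝ} {e : Set (ℝ × ℝ)} {T : Finset (ℕ × ℕ)}
    (hT : ∀ v : ℕ × ℕ, v ∈ T ↔ taylorCoeff S v.1 v.2 ≠ 0 ∧ ((v.1 : ℝ), (v.2 : ℝ)) ∈ e) (c : ℝ) :
    edgePoly S e c = ∑ v ∈ T, monomial v.2 (taylorCoeff S v.1 v.2 * c ^ v.1) := by
  classical
  rw [edgePoly, finsum_eq_sum_of_support_subset (s := T)]
  · refine Finset.sum_congr rfl fun v hv => ?_
    rw [finsum_eq_if, if_pos ((hT v).1 hv).2]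
  · intro v hv
    rw [Function.mem_support, finsum_eq_if] at hv
    split_ifs at hv with h
    · refine Finset.mem_coe.2 ((hT v).2 ⟨fun h0 => hv ?_, h⟩)
      rw [h0]; simp
    · exact absurd rfl hv

/-- In superadapted coordinates, if `(d, d)` is interior to a compact edge then near every point
close to the origin some partial derivative of order less than `d` is nonzero. -/
lemma eventually_exists_deriv_ne_zero_of_caseOne {S : ℝ × ℝ → ℝ} (hS : ContDiff ℝ ∞ S)
    (hsuper : IsSuperadapted S) (hd0 : 0 < newtonDistance S) (h : NewtonCaseOne S) :
    ∀ᶠ p : ℝ × ℝ in 𝓝[≠] 0, ∃ k : ℕ, (k : ℝ) < newtonDistance S ∧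
      (yDeriv k S p ≠ 0 ∨ xDeriv k S p ≠ 0) := by
  obtain ⟨p, q, he, hd⟩ := h
  obtain ⟨w₁, w₂, hw₁, hw₂, hwd, -, hseg⟩ := exists_weights_of_isCompactEdge he hd0 hd
  obtain ⟨hy, hx⟩ := exists_taylorCoeff_ne_zero_lt_of_openSegment he.1 hw₁ hw₂ hseg hd
  have hdseg := openSegment_subset_segment ℝ p q hd
  have hdN : (newtonDistance S, newtonDistance S) ∈ newtonPolygon S := by
    have := hdseg
    rw [hseg] at this
    exact this.1
  refine eventually_exists_deriv_ne_zero hS (P := fun k => (k : ℝ) < newtonDistance S)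
    (by simpa using hd0) (D := ⌈newtonDistance S⌉₊)
    (fun k hk => by exact_mod_cast hk.le.trans (Nat.le_ceil _)) hy hx ?_
  intro s hs m sg r hsg hr T hT hT1 hT2 hT3
  obtain ⟨⟨x, hxT, hxd⟩, ⟨y, hyT, hyd⟩⟩ := exists_inadmissible_of_degenerate hs hsg hr hT hT1 hT3
  have hxT' := (hT1 x).1 hxT
  have hyT' := (hT1 y).1 hyT
  have hm := newtonDistance_eq_of_supporting hdN hs hT2
    (x := ((x.1 : ℝ), (x.2 : ℝ))) (y := ((y.1 : ℝ), (y.2 : ℝ)))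
    (mem_newtonPolygon_of_le hxT'.1 le_rfl le_rfl) (mem_newtonPolygon_of_le hyT'.1 le_rfl le_rfl)
    hxT'.2 hyT'.2 (not_lt.1 hxd) (not_lt.1 hyd)
  have hTe : ∀ v : ℕ × ℕ, v ∈ T ↔ taylorCoeff S v.1 v.2 ≠ 0 ∧
      ((v.1 : ℝ), (v.2 : ℝ)) ∈ segment ℝ p q := by
    intro v
    rw [hT1]
    refine and_congr_right fun hv => ?_
    exact (mem_segment_iff_of_supporting he.1 hwd hseg hd hs hT2 hm
      (t := ((v.1 : ℝ), (v.2 : ℝ))) (mem_newtonPolygon_of_le hv le_rfl le_rfl)).symm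
  set E := edgePoly S (segment ℝ p q) sg with hE
  have hEsum := edgePoly_eq_sum hTe sg
  rw [← hE] at hEsum
  have hsg0 : sg ≠ 0 := by rcases hsg with rfl | rfl <;> norm_num
  -- Points of `T` have distinct second coordinates, so no two monomials cancel.
  have hE0 : E ≠ 0 := by
    intro h0
    obtain ⟨v, hv⟩ := hT
    have hc : E.coeff v.2 = taylorCoeff S v.1 v.2 * sg ^ v.1 := by
      rw [hEsum, finsetSum_coeff, Finset.sum_eq_single_of_mem v hv fun w hw hwv => ?_]
      · rw [coeff_monomial, if_pos rfl]
      · rw [coeff_monomial, if_neg]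
        intro hwv2
        have e1 := ((hT1 v).1 hv).2
        have e2 := ((hT1 w).1 hw).2
        rw [hwv2] at e2
        refine hwv (Prod.ext ?_ hwv2)
        have : (w.1 : ℝ) = v.1 := by linarith
        exact_mod_cast this
    rw [h0, coeff_zero] at hc
    exact mul_ne_zero ((hT1 v).1 hv).1 (pow_ne_zero _ hsg0) hc.symm
  have hroot : ∀ k : ℕ, (k : ℝ) < newtonDistance S → (derivative^[k] E).IsRoot r := by
    intro k hk
    have h1 : r ^ k * (derivative^[k] E).eval r = 0 := by
      rw [hEsum, iterate_derivative_sum, eval_finsetSum, Finset.mul_sum, ← (hT3 k hk).1]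
      refine Finset.sum_congr rfl fun v _ => ?_
      rw [pow_mul_eval_iterate_derivative_monomial]
    exact (mul_eq_zero.1 h1).resolve_left (pow_ne_zero _ hr)
  -- The multiplicity of `r` is below `d`, while all derivatives of order below `d` vanish at `r`;
  -- so it would exceed itself.
  have hmult := hsuper p q he ⟨_, hdseg⟩ sg hsg r hr (hroot 0 (by simpa using hd0))
  refine lt_irrefl _ ((lt_rootMultiplicity_iff_isRoot_iterate_derivative hE0).2 fun k hk =>
    hroot k (lt_of_le_of_lt (by exact_mod_cast hk) hmult))

/-- If `(d, d)` is a vertex then near every point close to the origin some partial derivative of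
order at most `d` is nonzero. -/
lemma eventually_exists_deriv_ne_zero_of_caseTwo {S : ℝ × ℝ → ℝ} (hS : ContDiff ℝ ∞ S)
    (hd0 : 0 < newtonDistance S) (h : NewtonCaseTwo S) :
    ∀ᶠ p : ℝ × ℝ in 𝓝[≠] 0, ∃ k : ℕ, (k : ℝ) ≤ newtonDistance S ∧
      (yDeriv k S p ≠ 0 ∨ xDeriv k S p ≠ 0) := by
  obtain ⟨n, hn, hnn, -⟩ := exists_taylorCoeff_ne_zero_of_vertex h
  have hdN : (newtonDistance S, newtonDistance S) ∈ newtonPolygon S := extremePoints_subset h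
  refine eventually_exists_deriv_ne_zero hS (P := fun k => (k : ℝ) ≤ newtonDistance S)
    (by simpa using hd0.le) (D := n) (fun k hk => by rw [hn] at hk; exact_mod_cast hk)
    ⟨n, n, hnn, hn.ge⟩ ⟨n, n, hnn, hn.ge⟩ ?_
  intro s hs m sg r hsg hr T hT hT1 hT2 hT3
  obtain ⟨⟨x, hxT, hxd⟩, ⟨y, hyT, hyd⟩⟩ := exists_inadmissible_of_degenerate hs hsg hr hT hT1 hT3
  have hxT' := (hT1 x).1 hxT
  have hyT' := (hT1 y).1 hyT
  have hxN : ((x.1 : ℝ), (x.2 : ℝ)) ∈ newtonPolygon S :=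
    mem_newtonPolygon_of_le hxT'.1 le_rfl le_rfl
  have hyN : ((y.1 : ℝ), (y.2 : ℝ)) ∈ newtonPolygon S :=
    mem_newtonPolygon_of_le hyT'.1 le_rfl le_rfl
  simp only [not_le] at hxd hyd
  have hm := newtonDistance_eq_of_supporting hdN hs hT2 hxN hyN hxT'.2 hyT'.2 hxd.le hyd.le
  -- Inadmissibility is now strict, `x.2 > d` and `y.1 > d`, so on a line through `(d, d)` the two
  -- points enclose it, against extremality.
  have hx1 : (x.1 : ℝ) < newtonDistance S := by
    nlinarith [hxT'.2, mul_lt_mul_of_pos_left hxd hs]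
  have hy2 : (y.2 : ℝ) < newtonDistance S := by
    by_contra! hc
    nlinarith [hyT'.2, mul_le_mul_of_nonneg_left hc hs.le]
  obtain ⟨t, ht, htm⟩ := exists_mem_openSegment_bisectrix (x := ((x.1 : ℝ), (x.2 : ℝ)))
    (y := ((y.1 : ℝ), (y.2 : ℝ))) hxT'.2 hyT'.2 (hx1.trans hxd) (hy2.trans hyd)
  have htd : t = newtonDistance S :=
    mul_left_cancel₀ (show 1 + s ≠ 0 by positivity) (htm.trans hm.symm)
  rw [htd] at ht
  have := congrArg Prod.fst ((mem_extremePoints.1 h).2 _ hxN _ hyN ht).1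
  exact hx1.ne this

/-! ### The sublevel integrals -/

lemma tendsto_div_rpow_pow {d : ℝ} (hd : 0 < d) {k : ℕ} (hk : (k : ℝ) < d) :
    Tendsto (fun ε : ℝ => ε / (ε ^ (1 / d)) ^ k) (𝓝[>] 0) (𝓝 0) := by
  have hpos : 0 < 1 - k / d := by rw [sub_pos, div_lt_one hd]; exact hk
  have h : Tendsto (fun ε : ℝ => ε ^ (1 - k / d)) (𝓝[>] 0) (𝓝 (0 ^ (1 - k / d))) :=
    (Real.continuousAt_rpow_const 0 _ (Or.inr hpos.le)).tendsto.mono_left nhdsWithin_le_nhds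
  rw [Real.zero_rpow hpos.ne'] at h
  refine h.congr' ?_
  filter_upwards [self_mem_nhdsWithin] with ε hε
  have hε0 : (0 : ℝ) < ε := hε
  rw [← Real.rpow_mul_natCast hε0.le, Real.rpow_sub hε0, Real.rpow_one]
  congr 2
  ring

/-- In the critical case `k = d` the quotient equals `|log ε| ^ (-d)`. -/
lemma tendsto_div_log_mul_rpow_pow {d : ℝ} (hd : 0 < d) {k : ℕ} (hk : (k : ℝ) ≤ d) :
    Tendsto (fun ε : ℝ => ε / (|Real.log ε| * ε ^ (1 / d)) ^ k) (𝓝[>] 0) (𝓝 0) := by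
  have hlog : Tendsto (fun ε : ℝ => |Real.log ε|) (𝓝[>] 0) atTop :=
    tendsto_abs_atBot_atTop.comp Real.tendsto_log_nhdsGT_zero
  rcases hk.lt_or_eq with hk | hk
  · refine squeeze_zero_norm' ?_ (tendsto_div_rpow_pow hd hk)
    filter_upwards [self_mem_nhdsWithin, hlog.eventually_ge_atTop 1] with ε hε h1
    have hε0 : (0 : ℝ) < ε := hε
    rw [Real.norm_eq_abs, abs_of_nonneg (by positivity)]
    refine div_le_div_of_nonneg_left hε0.le (by positivity) ?_
    refine pow_le_pow_left₀ (by positivity) ?_ k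
    exact le_mul_of_one_le_left (by positivity) h1
  · have hk0 : k ≠ 0 := by rintro rfl; simp at hk; linarith
    have h := tendsto_inv_atTop_zero.comp ((tendsto_pow_atTop hk0).comp hlog)
    refine h.congr' ?_
    filter_upwards [self_mem_nhdsWithin] with ε hε
    have hε0 : (0 : ℝ) < ε := hε
    have : (ε ^ (1 / d)) ^ k = ε := by
      rw [← Real.rpow_mul_natCast hε0.le, hk, one_div_mul_cancel hd.ne', Real.rpow_one]
    simp only [Function.comp]
    rw [mul_pow, this, mul_comm, ← div_div, div_self hε0.ne', one_div]

section SublevelIntegral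

variable {V : Set (ℝ × ℝ)} {S G φ : ℝ × ℝ → ℝ} {h : ℝ → ℝ}

lemma measurableSet_sublevel (hV : IsOpen V) (hS : ContinuousOn S V) (ε : ℝ) :
    MeasurableSet {p : ℝ × ℝ | p ∈ V ∧ |S p| < ε} :=
  (hS.abs.isOpen_inter_preimage hV isOpen_Iio).measurableSet

lemma exists_ball_half_le {U : Set (ℝ × ℝ)} (hU : IsOpen U) (hU0 : (0 : ℝ × ℝ) ∈ U)
    (hφ : Continuous φ) (hφ0 : 0 < φ 0) :
    ∃ r > 0, Metric.ball (0 : ℝ × ℝ) r ⊆ U ∧ ∀ p ∈ Metric.ball (0 : ℝ × ℝ) r, φ 0 / 2 ≤ φ p := by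
  have h1 : ∀ᶠ p in 𝓝 (0 : ℝ × ℝ), p ∈ U ∧ φ 0 / 2 ≤ φ p :=
    (hU.eventually_mem hU0).and ((hφ.tendsto 0).eventually (le_mem_nhds (by linarith)))
  obtain ⟨r, hr, hb⟩ := Metric.eventually_nhds_iff_ball.1 h1
  exact ⟨r, hr, fun p hp => (hb p hp).1, fun p hp => (hb p hp).2⟩

lemma mul_le_setIntegral_ball_inter (hG : Continuous G) (hφ : Continuous φ)
    (hφc : HasCompactSupport φ) {r a x ε : ℝ} (ha : 0 ≤ a)
    (hφr : ∀ p ∈ Metric.ball (0 : ℝ × ℝ) r, a ≤ φ p)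
    (hle : ENNReal.ofReal x ≤ volume (Metric.ball (0 : ℝ × ℝ) r ∩ {q | |G q| < ε})) :
    a * x ≤ ∫ p in Metric.ball (0 : ℝ × ℝ) r ∩ {q | |G q| < ε}, φ p := by
  have hfin : volume (Metric.ball (0 : ℝ × ℝ) r ∩ {q | |G q| < ε}) ≠ ⊤ :=
    ((measure_mono inter_subset_left).trans_lt measure_ball_lt_top).ne
  have hmeas : MeasurableSet (Metric.ball (0 : ℝ × ℝ) r ∩ {q | |G q| < ε}) :=
    (Metric.isOpen_ball.inter (isOpen_lt hG.abs continuous_const)).measurableSet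
  have h1 := setIntegral_ge_of_const_le_real (μ := volume) (c := a) hmeas hfin
    (fun p hp => hφr p hp.1) (hφ.integrable_of_hasCompactSupport hφc).integrableOn
  refine le_trans (mul_le_mul_of_nonneg_left ?_ ha) h1
  exact (ENNReal.ofReal_le_iff_le_toReal hfin).1 hle

/-- Lower bound for the sublevel integral of an amplitude of arbitrary sign away from the origin. -/
lemma exists_lt_absSublevelIntegral (hV : IsOpen V) (hS : ContinuousOn S V) (hG : ContDiff ℝ ∞ G)
    {U : Set (ℝ × ℝ)} (hU : IsOpen U) (hU0 : (0 : ℝ × ℝ) ∈ U) (hUV : U ⊆ V)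
    (hSG : ∀ p ∈ U, G p = S p) (hh : ∀ᶠ ε in 𝓝[>] (0 : ℝ), 0 < h ε)
    (hlow : ∃ c > 0, ∀ r > 0, ∀ᶠ ε in 𝓝[>] (0 : ℝ),
      ENNReal.ofReal (c * h ε) ≤ volume (Metric.ball (0 : ℝ × ℝ) r ∩ {q | |G q| < ε}))
    (hnd : ∀ p ∈ U, p ≠ 0 → ∃ k : ℕ, Tendsto (fun ε => ε / h ε ^ k) (𝓝[>] 0) (𝓝 0) ∧
      (yDeriv k G p ≠ 0 ∨ xDeriv k G p ≠ 0))
    (hφ : Continuous φ) (hφc : HasCompactSupport φ) (hφU : tsupport φ ⊆ U) (hφ0 : 0 < φ 0) :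
    ∃ A > 0, ∀ᶠ ε in 𝓝[>] (0 : ℝ), A * h ε < absSublevelIntegral V S φ ε := by
  obtain ⟨r, hr, hrU, hφr⟩ := exists_ball_half_le hU hU0 hφ hφ0
  obtain ⟨c, hc, hlow⟩ := hlow
  obtain ⟨M, hM⟩ := hφc.exists_bound_of_continuous hφ
  have hM0 : 0 ≤ M := (norm_nonneg _).trans (hM 0)
  set K := tsupport φ \ Metric.ball (0 : ℝ × ℝ) r with hK
  have hKc : IsCompact K := hφc.isCompact.diff Metric.isOpen_ball
  -- The outer part is then at most `φ 0 * c / 4 * h ε`, half of the lower bound for the inner part.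
  have hη : 0 < φ 0 * c / (4 * (M + 1)) := by positivity
  have hup := eventually_volume_inter_sublevel_le hG hh hKc (fun p hp => hnd p (hφU hp.1)
    (by rintro rfl; exact hp.2 (Metric.mem_ball_self hr))) hη
  refine ⟨φ 0 * c / 8, by positivity, ?_⟩
  filter_upwards [hh, hlow r hr, hup] with ε hε h1 h2
  set E₁ := Metric.ball (0 : ℝ × ℝ) r ∩ {q | |G q| < ε} with hE₁
  set E₂ := K ∩ {q | |G q| < ε} with hE₂
  have hopen : IsOpen {q | |G q| < ε} := isOpen_lt hG.continuous.abs continuous_const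
  have hE₂m : MeasurableSet E₂ := hKc.isClosed.measurableSet.inter hopen.measurableSet
  have hint : Integrable φ := hφ.integrable_of_hasCompactSupport hφc
  have hsplit : absSublevelIntegral V S φ ε = (∫ p in E₁, φ p) + ∫ p in E₂, φ p := by
    have hdisj : Disjoint E₁ E₂ := by
      rw [Set.disjoint_left]
      exact fun p hp hp' => hp'.1.2 hp.1
    rw [← setIntegral_union hdisj hE₂m hint.integrableOn hint.integrableOn, absSublevelIntegral]
    refine setIntegral_eq_of_subset_of_forall_sdiff_eq_zero (measurableSet_sublevel hV hS ε) ?_ ?_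
    · rintro p (⟨hp, hp'⟩ | ⟨hp, hp'⟩)
      · exact ⟨hUV (hrU hp), by rw [← hSG p (hrU hp)]; exact hp'⟩
      · exact ⟨hUV (hφU hp.1), by rw [← hSG p (hφU hp.1)]; exact hp'⟩
    · rintro p ⟨⟨hpV, hpε⟩, hpn⟩
      by_contra hne
      have hps : p ∈ tsupport φ := subset_tsupport φ hne
      rw [← hSG p (hφU hps)] at hpε
      by_cases hpb : p ∈ Metric.ball (0 : ℝ × ℝ) r
      · exact hpn (Or.inl ⟨hpb, hpε⟩)
      · exact hpn (Or.inr ⟨⟨hps, hpb⟩, hpε⟩)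
  have i1 : φ 0 / 2 * (c * h ε) ≤ ∫ p in E₁, φ p :=
    mul_le_setIntegral_ball_inter hG.continuous hφ hφc (by linarith) hφr h1
  have i2 : ‖∫ p in E₂, φ p‖ ≤ M * (φ 0 * c / (4 * (M + 1)) * h ε) := by
    have hfin : volume E₂ < ⊤ := h2.trans_lt ENNReal.ofReal_lt_top
    refine (norm_setIntegral_le_of_norm_le_const hfin fun p _ => hM p).trans ?_
    refine mul_le_mul_of_nonneg_left ?_ hM0
    exact ENNReal.toReal_le_of_le_ofReal (by positivity) h2
  have i3 : M * (φ 0 * c / (4 * (M + 1)) * h ε) ≤ φ 0 * c / 4 * h ε := by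
    have : M * (φ 0 * c / (4 * (M + 1)) * h ε) = M / (M + 1) * (φ 0 * c / 4 * h ε) := by
      field_simp
    rw [this]
    exact mul_le_of_le_one_left (by positivity) ((div_le_one (by positivity)).2 (by linarith))
  rw [Real.norm_eq_abs] at i2
  have i4 := neg_abs_le (∫ p in E₂, φ p)
  have i5 : 0 < φ 0 * c * h ε := by positivity
  rw [hsplit]
  linarith

/-- Lower bound for the sublevel integral of a nonnegative amplitude. -/
lemma exists_lt_absSublevelIntegral_of_nonneg (hG : Continuous G) {U : Set (ℝ × ℝ)} (hU : IsOpen U) (hU0 : (0 : ℝ × ℝ) ∈ U) (hUV : U ⊆ V)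
    (hSG : ∀ p ∈ U, G p = S p) (hh : ∀ᶠ ε in 𝓝[>] (0 : ℝ), 0 < h ε)
    (hlow : ∃ c > 0, ∀ r > 0, ∀ᶠ ε in 𝓝[>] (0 : ℝ),
      ENNReal.ofReal (c * h ε) ≤ volume (Metric.ball (0 : ℝ × ℝ) r ∩ {q | |G q| < ε}))
    (hφ : Continuous φ) (hφc : HasCompactSupport φ) (hφ0 : 0 < φ 0) (hφn : ∀ p, 0 ≤ φ p) :
    ∃ A > 0, ∀ᶠ ε in 𝓝[>] (0 : ℝ), A * h ε < absSublevelIntegral V S φ ε := by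
  obtain ⟨r, hr, hrU, hφr⟩ := exists_ball_half_le hU hU0 hφ hφ0
  obtain ⟨c, hc, hlow⟩ := hlow
  refine ⟨φ 0 * c / 4, by positivity, ?_⟩
  filter_upwards [hh, hlow r hr] with ε hε h1
  have i1 := mul_le_setIntegral_ball_inter hG hφ hφc (by linarith) hφr h1
  have i2 : ∫ p in Metric.ball (0 : ℝ × ℝ) r ∩ {q | |G q| < ε}, φ p ≤
      absSublevelIntegral V S φ ε := by
    refine setIntegral_mono_set (hφ.integrable_of_hasCompactSupport hφc).integrableOn
      (Eventually.of_forall hφn) (LE.le.eventuallyLE ?_)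
    rintro p ⟨hp, hp'⟩
    exact ⟨hUV (hrU hp), by rw [← hSG p (hrU hp)]; exact hp'⟩
  have i5 : 0 < φ 0 * c * h ε := by positivity
  linarith

end SublevelIntegral

/-! ### Reduction to a globally defined function -/

/-- Multiplying by a bump function gives a global smooth function with the same germ at 0, which
determines all Newton data. -/
lemma exists_contDiff_eqOn_ball {V : Set (ℝ × ℝ)} (hV : IsOpen V) (hV0 : (0 : ℝ × ℝ) ∈ V)
    {S : ℝ × ℝ → ℝ} (hS : ContDiffOn ℝ ∞ S V) :
    ∃ G : ℝ × ℝ → ℝ, ContDiff ℝ ∞ G ∧ ∃ r > 0, Metric.ball (0 : ℝ × ℝ) r ⊆ V ∧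
      ∀ p ∈ Metric.ball (0 : ℝ × ℝ) r, G p = S p := by
  obtain ⟨R, hR, hRV⟩ := Metric.nhds_basis_closedBall.mem_iff.1 (hV.mem_nhds hV0)
  let χ : ContDiffBump (0 : ℝ × ℝ) := ⟨R / 2, R, by positivity, by linarith⟩
  refine ⟨fun p => χ p * S p, contDiff_iff_contDiffAt.2 fun p => ?_, R / 2, by positivity,
    (Metric.ball_subset_closedBall.trans (Metric.closedBall_subset_closedBall (by linarith))).trans
      hRV, fun p hp => ?_⟩
  · by_cases hp : p ∈ V
    · exact χ.contDiff.contDiffAt.mul (hS.contDiffAt (hV.mem_nhds hp))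
    · have hp' : p ∉ tsupport χ := fun h => hp (hRV (by rwa [χ.tsupport_eq] at h))
      have hev : (fun p => χ p * S p) =ᶠ[𝓝 p] fun _ => 0 := by
        filter_upwards [(isClosed_tsupport χ).isOpen_compl.mem_nhds hp'] with q hq
        rw [image_eq_zero_of_notMem_tsupport hq, zero_mul]
      exact contDiffAt_const.congr_of_eventuallyEq hev
  · simp only
    rw [χ.one_of_mem_closedBall (Metric.ball_subset_closedBall hp), one_mul]

lemma taylorCoeff_congr {S G : ℝ × ℝ → ℝ} {r : ℝ} (hr : 0 < r)
    (h : ∀ p ∈ Metric.ball (0 : ℝ × ℝ) r, G p = S p) : taylorCoeff G = taylorCoeff S := by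
  ext a b
  have h1 : (fun x : ℝ => iteratedDeriv b (fun y : ℝ => G (x, y)) 0) =ᶠ[𝓝 0]
      fun x : ℝ => iteratedDeriv b (fun y : ℝ => S (x, y)) 0 := by
    filter_upwards [Metric.ball_mem_nhds (0 : ℝ) hr] with x hx
    refine Filter.EventuallyEq.iteratedDeriv_eq b ?_
    filter_upwards [Metric.ball_mem_nhds (0 : ℝ) hr] with y hy
    refine h _ ?_
    rw [show (0 : ℝ × ℝ) = (0, 0) from rfl, ← ball_prod_same]
    exact ⟨hx, hy⟩
  rw [taylorCoeff, taylorCoeff, h1.iteratedDeriv_eq a]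

lemma exists_isOpen_of_eventually_punctured {P : ℝ × ℝ → Prop} (h : ∀ᶠ p in 𝓝[≠] 0, P p) :
    ∃ U : Set (ℝ × ℝ), IsOpen U ∧ 0 ∈ U ∧ ∀ p ∈ U, p ≠ 0 → P p := by
  obtain ⟨U, hU, hUo, hU0⟩ := eventually_nhds_iff.1 (eventually_nhdsWithin_iff.1 h)
  exact ⟨U, hUo, hU0, hU⟩

theorem theorem1
    (V : Set (ℝ × ℝ)) (hV : IsOpen V) (hV0 : (0 : ℝ × ℝ) ∈ V)
    (S : ℝ × ℝ → ℝ) (hS : ContDiffOn ℝ ∞ S V)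
    (hS0 : S 0 = 0) (hdS0 : fderiv ℝ S 0 = 0)
    (hTaylor : ∃ a b : ℕ, taylorCoeff S a b ≠ 0)
    (hsuper : IsSuperadapted S) (hd : 1 < newtonDistance S) :
    ∃ U : Set (ℝ × ℝ), IsOpen U ∧ (0 : ℝ × ℝ) ∈ U ∧ U ⊆ V ∧
      ∀ φ : ℝ × ℝ → ℝ, ContDiff ℝ ∞ φ → HasCompactSupport φ → tsupport φ ⊆ U → φ 0 ≠ 0 →
        (NewtonCaseOne S → ∃ A : ℝ, 0 < A ∧ ∀ᶠ ε : ℝ in 𝓝[>] 0,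
          (0 < φ 0 →
            A * ε ^ (1 / newtonDistance S) < absSublevelIntegral V S φ ε) ∧
          (φ 0 < 0 →
            absSublevelIntegral V S φ ε < -(A * ε ^ (1 / newtonDistance S)))) ∧
        (NewtonCaseTwo S → ∃ A : ℝ, 0 < A ∧ ∀ᶠ ε : ℝ in 𝓝[>] 0,
          (0 < φ 0 →
            A * |Real.log ε| * ε ^ (1 / newtonDistance S) < absSublevelIntegral V S φ ε) ∧
          (φ 0 < 0 →
            absSublevelIntegral V S φ ε < -(A * |Real.log ε| * ε ^ (1 / newtonDistance S)))) ∧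
        (NewtonCaseThree S → (∀ p : ℝ × ℝ, 0 ≤ φ p) → ∀ δ : ℝ, 0 < δ →
          ∃ A : ℝ, 0 < A ∧ ∀ᶠ ε : ℝ in 𝓝[>] 0,
            A * ε ^ (1 / newtonDistance S + δ) < absSublevelIntegral V S φ ε) := by
  obtain ⟨G, hG, r, hr, hrV, hGS⟩ := exists_contDiff_eqOn_ball hV hV0 hS
  have htc := taylorCoeff_congr hr hGS
  have hN : newtonPolygon G = newtonPolygon S := by simp only [newtonPolygon, htc]
  have hD : newtonDistance G = newtonDistance S := by simp only [newtonDistance, hN]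
  have hE : IsCompactEdge G = IsCompactEdge S := by
    ext p q; simp only [IsCompactEdge, hN]
  have hsuperG : IsSuperadapted G := by
    simpa only [IsSuperadapted, hE, hD, edgePoly, htc] using hsuper
  have h1 : NewtonCaseOne G = NewtonCaseOne S := by simp only [NewtonCaseOne, hE, hD]
  have h2 : NewtonCaseTwo G = NewtonCaseTwo S := by simp only [NewtonCaseTwo, hN, hD]
  have h3 : NewtonCaseThree G = NewtonCaseThree S := by simp only [NewtonCaseThree, hN, hD]
  rw [← hD] at hd ⊢
  rw [← h1, ← h2, ← h3]
  set d := newtonDistance G with hd_def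
  have hd0 : 0 < d := by linarith
  -- The neighborhoods are fixed before `φ` is given, so that `U` depends only on `S`; if a case
  -- does not occur, it imposes no restriction.
  obtain ⟨U₁, hU₁, hU₁0, hnd₁⟩ : ∃ U : Set (ℝ × ℝ), IsOpen U ∧ 0 ∈ U ∧ (NewtonCaseOne G →
      ∀ p ∈ U, p ≠ 0 → ∃ k : ℕ, (k : ℝ) < d ∧ (yDeriv k G p ≠ 0 ∨ xDeriv k G p ≠ 0)) := by
    by_cases hc : NewtonCaseOne G
    · obtain ⟨U, h⟩ := exists_isOpen_of_eventually_punctured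
        (eventually_exists_deriv_ne_zero_of_caseOne hG hsuperG hd0 hc)
      exact ⟨U, h.1, h.2.1, fun _ => h.2.2⟩
    · exact ⟨univ, isOpen_univ, mem_univ _, fun h => absurd h hc⟩
  obtain ⟨U₂, hU₂, hU₂0, hnd₂⟩ : ∃ U : Set (ℝ × ℝ), IsOpen U ∧ 0 ∈ U ∧ (NewtonCaseTwo G →
      ∀ p ∈ U, p ≠ 0 → ∃ k : ℕ, (k : ℝ) ≤ d ∧ (yDeriv k G p ≠ 0 ∨ xDeriv k G p ≠ 0)) := by
    by_cases hc : NewtonCaseTwo G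
    · obtain ⟨U, h⟩ := exists_isOpen_of_eventually_punctured
        (eventually_exists_deriv_ne_zero_of_caseTwo hG hd0 hc)
      exact ⟨U, h.1, h.2.1, fun _ => h.2.2⟩
    · exact ⟨univ, isOpen_univ, mem_univ _, fun h => absurd h hc⟩
  set U := Metric.ball (0 : ℝ × ℝ) r ∩ U₁ ∩ U₂ with hU_def
  have hU : IsOpen U := (Metric.isOpen_ball.inter hU₁).inter hU₂
  have hU0 : (0 : ℝ × ℝ) ∈ U := ⟨⟨Metric.mem_ball_self hr, hU₁0⟩, hU₂0⟩
  have hUV : U ⊆ V := fun p hp => hrV hp.1.1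
  have hUG : ∀ p ∈ U, G p = S p := fun p hp => hGS p hp.1.1
  have hsigned : ∀ h : ℝ → ℝ, (∀ᶠ ε in 𝓝[>] (0 : ℝ), 0 < h ε) →
      (∃ c > 0, ∀ r > 0, ∀ᶠ ε in 𝓝[>] (0 : ℝ),
        ENNReal.ofReal (c * h ε) ≤ volume (Metric.ball (0 : ℝ × ℝ) r ∩ {q | |G q| < ε})) →
      (∀ p ∈ U, p ≠ 0 → ∃ k : ℕ, Tendsto (fun ε => ε / h ε ^ k) (𝓝[>] 0) (𝓝 0) ∧
        (yDeriv k G p ≠ 0 ∨ xDeriv k G p ≠ 0)) →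
      ∀ φ : ℝ × ℝ → ℝ, Continuous φ → HasCompactSupport φ → tsupport φ ⊆ U → φ 0 ≠ 0 →
        ∃ A : ℝ, 0 < A ∧ ∀ᶠ ε : ℝ in 𝓝[>] 0,
          (0 < φ 0 → A * h ε < absSublevelIntegral V S φ ε) ∧
          (φ 0 < 0 → absSublevelIntegral V S φ ε < -(A * h ε)) := by
    intro h hh hlow hnd φ hφ hφc hφU hφ0
    rcases lt_or_gt_of_ne hφ0 with hneg | hpos
    · obtain ⟨A, hA, hev⟩ := exists_lt_absSublevelIntegral (φ := fun p => -φ p) hV hS.continuousOn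
        hG hU hU0 hUV hUG hh hlow hnd hφ.neg
        hφc.neg (by
          refine (closure_mono ?_).trans hφU
          exact fun p hp h0 => hp (by simp [h0])) (neg_pos.2 hneg)
      refine ⟨A, hA, hev.mono fun ε hε => ⟨fun h0 => absurd h0 hneg.le.not_gt, fun _ => ?_⟩⟩
      rw [absSublevelIntegral, integral_neg] at hε
      rw [absSublevelIntegral]
      linarith
    · obtain ⟨A, hA, hev⟩ := exists_lt_absSublevelIntegral hV hS.continuousOn
        hG hU hU0 hUV hUG hh hlow hnd hφ hφc hφU hpos
      exact ⟨A, hA, hev.mono fun ε hε => ⟨fun _ => hε, fun h0 => absurd h0 hpos.le.not_gt⟩⟩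
  refine ⟨U, hU, hU0, hUV, fun φ hφ hφc hφU hφ0 => ⟨fun hc => ?_, fun hc => ?_,
    fun hc hφn δ hδ => ?_⟩⟩
  · refine hsigned (fun ε => ε ^ (1 / d)) ?_ ?_ ?_ φ hφ.continuous hφc hφU hφ0
    · filter_upwards [self_mem_nhdsWithin] with ε hε
      exact Real.rpow_pos_of_pos hε _
    · have hc' := hc
      obtain ⟨p, q, he, hd'⟩ := hc'
      obtain ⟨w₁, w₂, hw₁, hw₂, hwd, hle, -⟩ := exists_weights_of_isCompactEdge he hd0 hd'
      have hw : 1 / d = w₁ + w₂ := by rw [div_eq_iff hd0.ne', hwd]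
      rw [hw]
      exact exists_le_volume_ball_inter_sublevel hG hw₁ hw₂ fun a b hab =>
        hle (a, b) (mem_newtonPolygon_of_le hab le_rfl le_rfl)
    · intro p hp hp0
      obtain ⟨k, hk, hk'⟩ := hnd₁ hc p hp.1.2 hp0
      exact ⟨k, tendsto_div_rpow_pow hd0 hk, hk'⟩
  · simp only [mul_assoc]
    refine hsigned (fun ε => |Real.log ε| * ε ^ (1 / d)) ?_ ?_ ?_ φ hφ.continuous hφc hφU hφ0
    · filter_upwards [eventually_pos_lt_one] with ε hε
      exact mul_pos (abs_pos.2 (Real.log_neg hε.1 hε.2).ne) (Real.rpow_pos_of_pos hε.1 _)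
    · obtain ⟨s₁, s₂, hs₁, hs, hs₂, hw⟩ := exists_interval_weights_of_vertex hc hd0
      exact exists_le_volume_ball_inter_sublevel_log hG hs₁ hs hs₂ hw
    · intro p hp hp0
      obtain ⟨k, hk, hk'⟩ := hnd₂ hc p hp.2 hp0
      exact ⟨k, tendsto_div_log_mul_rpow_pow hd0 hk, hk'⟩
  · have hφpos : 0 < φ 0 := lt_of_le_of_ne (hφn 0) hφ0.symm
    refine exists_lt_absSublevelIntegral_of_nonneg (h := fun ε => ε ^ (1 / d + δ))
      hG.continuous hU hU0 hUV hUG ?_ ?_ hφ.continuous hφc hφpos hφn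
    · filter_upwards [self_mem_nhdsWithin] with ε hε
      exact Real.rpow_pos_of_pos hε _
    · have hdi : 0 < 1 / d := by positivity
      have hmul : ∀ t : ℝ, d ≤ t → 1 ≤ 1 / d * t := fun t ht => by
        rw [one_div_mul_eq_div, one_le_div hd0]; exact ht
      -- Weight `1 / d` goes to the coordinate that is at least `d` on the support; the other one
      -- can have the arbitrarily small weight `δ`.
      rcases newtonDistance_le_of_caseThree hc with h | h
      · rw [add_comm]
        refine exists_le_volume_ball_inter_sublevel hG hδ hdi fun a b hab => ?_
        have := hmul b (h a b hab)
        have : 0 ≤ δ * a := by positivity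
        linarith
      · refine exists_le_volume_ball_inter_sublevel hG hdi hδ fun a b hab => ?_
        have := hmul a (h a b hab)
        have : 0 ≤ δ * b := by positivity
        linarith
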